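/- **Proposition 2.1.** Let $M$ be a complex manifold of dimension $n\ge 1$ (for example a compact Kähler manifold), let $L$ be a holomorphic line bundle on $M$, and let $\omega\in H^0(M,S^2\Omega^1_M\otimes L)$ be a holomorphic conformal structure, i.e. $\omega$ is nondegenerate at every point. Conventions. For a holomorphic vector bundle $W$ with local holomorphic frames $e_\alpha$ and transition functions $g_{\alpha\beta}$, $e_\beta^k=\sum_l g_{\alpha\beta}^{lk}e_\alpha^l$, let $a(W)\in H^1(M,\Omega^1_M\otimes\mathcal{E}nd(W))$ be the class of the Čech cocycle $$a(W)_{\alpha\beta}=\frac1{2\pi i}\sum_{j,l}dg_{\alpha\beta}^{jl}\otimes e_\alpha^j\otimes e_\beta^{l*}$$ ($-\frac1{2\pi i}$ times the Atiyah class of $W$). For a line bundle, let $c_1\in H^1(M,\Omega^1_M)$ be the class of $\frac1{2\pi i}\,d\log g_{\alpha\beta}$. Let $K_M=\det\Omega^1_M$. Identify $\Omega^1_M\otimes\mathcal{E}nd(\Omega^1_M)$ with $\Omega^1_M\otimes\Omega^1_M\otimes T_M$. For $\xi\in H^1(M,\Omega^1_M)$ let $\mathrm{id}\otimes\xi$ and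 $\xi\otimes\mathrm{id}$ be the classes in $H^1(M,\Omega^1_M\otimes\mathcal{E}nd(\Omega^1_M))$ induced by the bundle maps which send a covector $\xi$ to $v\mapsto \xi(v)\,\mathrm{id}_{\Omega^1_M}$ and to $v\mapsto(\lambda\mapsto\lambda(v)\,\xi)$. Let $\omega^{-1}:\Omega^1_M\to T_M\otimes L^*$ be the inverse of the isomorphism $T_M\otimes L^*\to\Omega^1_M$ induced by $\omega$, and let $\omega\otimes\omega^{-1}(\xi)\in H^1(M,S^2\Omega^1_M\otimes T_M)$ be obtained by tensoring $\omega^{-1}(\xi)\in H^1(M,T_M\otimes L^*)$ with $\omega$ and contracting $L\otimes L^*$. Then the inclusion $S^2\Omega^1_M\otimes T_M\subset\Omega^1_M\otimes\mathcal{E}nd(\Omega^1_M)$ is injective on $H^1$, the classes $a(\Omega^1_M)$ and $\mathrm{id}\otimes\frac{c_1(K_M)}n+\frac{c_1(K_M)}n\otimes\mathrm{id}$ lie in $H^1(M,S^2\Omega^1_M\otimes T_M)$, and there $$a(\Omega^1_M)=\mathrm{id}\otimes\frac{c_1(K_M)}n+\frac{c_1(K_M)}n\otimes\mathrm{id}-\frac1n\,\omega\otimes\omega^{-1}(c_1(K_M)).$$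 -/

import Mathlib

open Bundle TopologicalSpace Set
open scoped Manifold ContDiff Topology

noncomputable section

set_option synthInstance.maxHeartbeats 200000

/-! ### Presheaves of sections and first Čech cohomology -/

/-- A presheaf of complex vector spaces on `M` whose sections over `U` are (certain) families of
vectors `s x ∈ V x`, `x ∈ U`, with the obvious restriction maps. -/
structure SectionPresheaf {M : Type*} [TopologicalSpace M] (V : M → Type*)
    [∀ x, AddCommGroup (V x)] [∀ x, Module ℂ (V x)] where
  sections : (U : Opens M) → Submodule ℂ (Π x : U, V x)
  restrict_mem : ∀ {U W : Opens M} (h : U ≤ W) (s : Π x : W, V x),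
    s ∈ sections W → (fun x : U => s ⟨x, h x.2⟩) ∈ sections U

/-- An open cover of `M` indexed by the points of `M`, the set with index `x` containing `x`.
Every open cover is refined by one of this form. -/
structure PointCover (M : Type*) [TopologicalSpace M] where
  nhd : M → Opens M
  mem_nhd : ∀ x, x ∈ nhd x

/-- `𝒰 ≤ 𝒱` means that `𝒱` refines `𝒰`. -/
instance {M : Type*} [TopologicalSpace M] : Preorder (PointCover M) where
  le 𝒰 𝒱 := ∀ x, 𝒱.nhd x ≤ 𝒰.nhd x
  le_refl _ _ := le_rfl
  le_trans _ _ _ h h' x := (h' x).trans (h x)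

namespace SectionPresheaf

variable {M : Type*} [TopologicalSpace M]
  {V : M → Type*} [∀ x, AddCommGroup (V x)] [∀ x, Module ℂ (V x)]
  {W : M → Type*} [∀ x, AddCommGroup (W x)] [∀ x, Module ℂ (W x)]

/-- The restriction map from `W` to `U ⊆ W`. -/
def res (A : SectionPresheaf V) {U W : Opens M} (h : U ≤ W) : A.sections W →ₗ[ℂ] A.sections U where
  toFun s := ⟨fun x => s.1 ⟨x, h x.2⟩, A.restrict_mem h s.1 s.2⟩
  map_add' _ _ := rfl
  map_smul' _ _ := rfl

variable (A : SectionPresheaf V) (B : SectionPresheaf W) (𝒰 : PointCover M)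

/-- Čech 0-cochains. -/
def C0 := Π x : M, A.sections (𝒰.nhd x)

/-- Čech 1-cochains. -/
def C1 := Π x y : M, A.sections (𝒰.nhd x ⊓ 𝒰.nhd y)

/-- Čech 2-cochains. -/
def C2 := Π x y z : M, A.sections (𝒰.nhd x ⊓ 𝒰.nhd y ⊓ 𝒰.nhd z)

instance : AddCommGroup (A.C0 𝒰) :=
  inferInstanceAs (AddCommGroup (Π x : M, A.sections (𝒰.nhd x)))
instance : Module ℂ (A.C0 𝒰) :=
  inferInstanceAs (Module ℂ (Π x : M, A.sections (𝒰.nhd x)))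
instance : AddCommGroup (A.C1 𝒰) :=
  inferInstanceAs (AddCommGroup (Π x y : M, A.sections (𝒰.nhd x ⊓ 𝒰.nhd y)))
instance : Module ℂ (A.C1 𝒰) :=
  inferInstanceAs (Module ℂ (Π x y : M, A.sections (𝒰.nhd x ⊓ 𝒰.nhd y)))
instance : AddCommGroup (A.C2 𝒰) :=
  inferInstanceAs (AddCommGroup (Π x y z : M, A.sections (𝒰.nhd x ⊓ 𝒰.nhd y ⊓ 𝒰.nhd z)))
instance : Module ℂ (A.C2 𝒰) :=
  inferInstanceAs (Module ℂ (Π x y z : M, A.sections (𝒰.nhd x ⊓ 𝒰.nhd y ⊓ 𝒰.nhd z)))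

/-- The Čech differential, `(δf)_{xy} = f_y - f_x`. -/
def d0 : A.C0 𝒰 →ₗ[ℂ] A.C1 𝒰 where
  toFun f x y := A.res inf_le_right (f y) - A.res inf_le_left (f x)
  map_add' f g := by
    funext x y
    change A.res _ (f y + g y) - A.res _ (f x + g x) =
      (A.res _ (f y) - A.res _ (f x)) + (A.res _ (g y) - A.res _ (g x))
    simp only [map_add]
    abel
  map_smul' c f := by
    funext x y
    change A.res _ (c • f y) - A.res _ (c • f x) = c • (A.res _ (f y) - A.res _ (f x))
    simp only [map_smul, smul_sub]

/-- The Čech differential, `(δf)_{xyz} = f_{yz} - f_{xz} + f_{xy}`. -/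
def d1 : A.C1 𝒰 →ₗ[ℂ] A.C2 𝒰 where
  toFun f x y z := A.res (inf_le_inf_right _ inf_le_right) (f y z)
    - A.res (inf_le_inf_right _ inf_le_left) (f x z) + A.res inf_le_left (f x y)
  map_add' f g := by
    funext x y z
    change A.res _ (f y z + g y z) - A.res _ (f x z + g x z) + A.res _ (f x y + g x y) =
      (A.res _ (f y z) - A.res _ (f x z) + A.res _ (f x y)) +
      (A.res _ (g y z) - A.res _ (g x z) + A.res _ (g x y))
    simp only [map_add]
    abel
  map_smul' c f := by
    funext x y z
    change A.res _ (c • f y z) - A.res _ (c • f x z) + A.res _ (c • f x y) =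
      c • (A.res _ (f y z) - A.res _ (f x z) + A.res _ (f x y))
    simp only [map_smul, smul_sub, smul_add]

/-- Čech 1-cocycles. -/
def Z1 : Submodule ℂ (A.C1 𝒰) := LinearMap.ker (A.d1 𝒰)

/-- Čech 1-coboundaries, as a subspace of the space of 1-cocycles. -/
def B1 : Submodule ℂ (A.Z1 𝒰) := (LinearMap.range (A.d0 𝒰)).comap (A.Z1 𝒰).subtype

/-- The first Čech cohomology of the cover `𝒰`: cocycles modulo coboundaries. -/
def coverH1 := A.Z1 𝒰 ⧸ A.B1 𝒰

instance : AddCommGroup (A.coverH1 𝒰) := inferInstanceAs (AddCommGroup (A.Z1 𝒰 ⧸ A.B1 𝒰))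
instance : Module ℂ (A.coverH1 𝒰) := inferInstanceAs (Module ℂ (A.Z1 𝒰 ⧸ A.B1 𝒰))

variable {𝒰} in
/-- Restriction of 1-cocycles to a finer cover. -/
def refineZ1 {𝒱 : PointCover M} (h : 𝒰 ≤ 𝒱) : A.Z1 𝒰 →ₗ[ℂ] A.Z1 𝒱 where
  toFun f := ⟨fun x y => A.res (inf_le_inf (h x) (h y)) (f.1 x y), by
    have hf : A.d1 _ f.1 = 0 := f.2
    funext x y z
    exact congrArg (A.res (inf_le_inf (inf_le_inf (h x) (h y)) (h z)))
      (congrFun (congrFun (congrFun hf x) y) z)⟩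
  map_add' _ _ := rfl
  map_smul' _ _ := rfl

variable {𝒰} in
/-- The map induced on `coverH1` by refinement. -/
def refineH1 {𝒱 : PointCover M} (h : 𝒰 ≤ 𝒱) : A.coverH1 𝒰 →ₗ[ℂ] A.coverH1 𝒱 :=
  Submodule.mapQ (A.B1 𝒰) (A.B1 𝒱) (A.refineZ1 h) (by
    rintro ⟨f, hf⟩ ⟨g, hg⟩
    exact ⟨fun x => A.res (h x) (g x), by
      funext x y
      exact congrArg (A.res (inf_le_inf (h x) (h y))) (congrFun (congrFun hg x) y)⟩)

open Classical in
/-- The first (Čech) cohomology `H¹(M, A)`: the direct limit of the cohomology of open covers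
under refinement. -/
def H1 : Type _ :=
  Module.DirectLimit (fun 𝒰 : PointCover M => A.coverH1 𝒰) (fun _ _ h => A.refineH1 h)

open Classical in
instance : AddCommGroup A.H1 := inferInstanceAs (AddCommGroup
  (Module.DirectLimit (fun 𝒰 : PointCover M => A.coverH1 𝒰) (fun _ _ h => A.refineH1 h)))
open Classical in
instance : Module ℂ A.H1 := inferInstanceAs (Module ℂ
  (Module.DirectLimit (fun 𝒰 : PointCover M => A.coverH1 𝒰) (fun _ _ h => A.refineH1 h)))

variable {𝒰} in
open Classical in
/-- The class in `H¹(M, A)` of a Čech cocycle. -/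
def cls (f : A.Z1 𝒰) : A.H1 :=
  Module.DirectLimit.of ℂ (PointCover M) (fun 𝒰 => A.coverH1 𝒰) (fun _ _ h => A.refineH1 h) 𝒰
    ((A.B1 𝒰).mkQ f)

/-- A morphism of presheaves of sections given by a family of linear maps `V x → W x`. -/
structure Hom where
  toFun : Π x, V x →ₗ[ℂ] W x
  map_mem : ∀ (U : Opens M) (s : Π x : U, V x), s ∈ A.sections U →
    (fun x : U => toFun x (s x)) ∈ B.sections U

variable {A B}

/-- The map on sections over `U`. -/
def Hom.app (φ : A.Hom B) (U : Opens M) : A.sections U →ₗ[ℂ] B.sections U where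
  toFun s := ⟨fun x => φ.toFun x (s.1 x), φ.map_mem U s.1 s.2⟩
  map_add' _ _ := Subtype.ext <| funext fun x => map_add (φ.toFun x) _ _
  map_smul' _ _ := Subtype.ext <| funext fun x => map_smul (φ.toFun x) _ _

/-- The map induced on 1-cocycles. -/
def Hom.mapZ1 (φ : A.Hom B) : A.Z1 𝒰 →ₗ[ℂ] B.Z1 𝒰 where
  toFun f := ⟨fun x y => φ.app _ (f.1 x y), by
    have hf : A.d1 _ f.1 = 0 := f.2
    funext x y z
    have := congrArg (φ.app _) (congrFun (congrFun (congrFun hf x) y) z)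
    change φ.app _ (A.res _ (f.1 y z) - A.res _ (f.1 x z) + A.res _ (f.1 x y)) = φ.app _ 0 at this
    rw [map_add, map_sub, map_zero] at this
    exact this⟩
  map_add' f g := Subtype.ext <| funext fun x => funext fun y => map_add (φ.app _) _ _
  map_smul' c f := Subtype.ext <| funext fun x => funext fun y => map_smul (φ.app _) _ _

/-- The map induced on the cohomology of a cover. -/
def Hom.mapCoverH1 (φ : A.Hom B) : A.coverH1 𝒰 →ₗ[ℂ] B.coverH1 𝒰 :=
  Submodule.mapQ (A.B1 𝒰) (B.B1 𝒰) (φ.mapZ1 𝒰) (by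
    rintro ⟨f, hf⟩ ⟨g, hg⟩
    refine ⟨fun x => φ.app _ (g x), ?_⟩
    funext x y
    have := congrArg (φ.app _) (congrFun (congrFun hg x) y)
    change φ.app _ (A.res _ (g y) - A.res _ (g x)) = φ.app _ (f x y) at this
    rw [map_sub] at this
    exact this)

open Classical in
/-- The map `H¹(M, A) → H¹(M, B)` induced by a morphism `A → B`. -/
def Hom.mapH1 (φ : A.Hom B) : A.H1 →ₗ[ℂ] B.H1 :=
  Module.DirectLimit.map (fun 𝒰 => φ.mapCoverH1 𝒰) (by
    intro 𝒰 𝒱 h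
    apply Submodule.linearMap_qext
    rfl)

end SectionPresheaf

/-- `s` is a holomorphic section over `U` of the holomorphic vector bundle `V` with model fibre `F`
on the complex manifold `M` modelled on `E`. -/
def HolOn (E : Type*) [NormedAddCommGroup E] [NormedSpace ℂ E]
    {M : Type*} [TopologicalSpace M] [ChartedSpace E M]
    (F : Type*) [NormedAddCommGroup F] [NormedSpace ℂ F] {V : M → Type*}
    [TopologicalSpace (TotalSpace F V)] [∀ x, TopologicalSpace (V x)] [FiberBundle F V]
    (U : Set M) (s : Π x, V x) : Prop :=
  ContMDiffOn 𝓘(ℂ, E) (𝓘(ℂ, E).prod 𝓘(ℂ, F)) ω (fun x => TotalSpace.mk' F x (s x)) U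

section Bundles

variable {E : Type*} [NormedAddCommGroup E] [NormedSpace ℂ E]
  {M : Type*} [TopologicalSpace M] [ChartedSpace E M]
  {F₁ : Type*} [NormedAddCommGroup F₁] [NormedSpace ℂ F₁] {V₁ : M → Type*}
  [TopologicalSpace (TotalSpace F₁ V₁)] [∀ x, AddCommGroup (V₁ x)] [∀ x, Module ℂ (V₁ x)]
  [∀ x, TopologicalSpace (V₁ x)] [FiberBundle F₁ V₁] [VectorBundle ℂ F₁ V₁]
  {F₂ : Type*} [NormedAddCommGroup F₂] [NormedSpace ℂ F₂] {V₂ : M → Type*}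
  [TopologicalSpace (TotalSpace F₂ V₂)] [∀ x, AddCommGroup (V₂ x)] [∀ x, Module ℂ (V₂ x)]
  [∀ x, TopologicalSpace (V₂ x)] [FiberBundle F₂ V₂] [VectorBundle ℂ F₂ V₂]

variable (E F₁ V₁) in
/-- The sheaf of holomorphic sections of a holomorphic vector bundle. (That `s` is holomorphic on
`U` is expressed through an arbitrary extension of `s` to a set-theoretic section over `M`.) -/
def holSections : SectionPresheaf V₁ where
  sections U :=
    { carrier := {s | ∃ t : Π x : M, V₁ x, HolOn E F₁ U t ∧ ∀ x : U, t x = s x}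
      zero_mem' := ⟨fun _ => 0, fun x _ =>
        (contMDiff_zeroSection ℂ V₁).contMDiffAt.contMDiffWithinAt, fun _ => rfl⟩
      add_mem' := by
        rintro s s' ⟨t, ht, h⟩ ⟨t', ht', h'⟩
        exact ⟨t + t', ht.add_section ht', fun x => congrArg₂ (· + ·) (h x) (h' x)⟩
      smul_mem' := by
        rintro c s ⟨t, ht, h⟩
        exact ⟨c • t, ht.const_smul_section, fun x => congrArg (c • ·) (h x)⟩ }
  restrict_mem h s := by
    rintro ⟨t, ht, h'⟩
    exact ⟨t, ht.mono h, fun x => h' ⟨x, h x.2⟩⟩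

theorem HolOn.congr {U : Set M} {s t : Π x, V₁ x} (h : HolOn E F₁ U s) (h' : ∀ x ∈ U, t x = s x) :
    HolOn E F₁ U t :=
  ContMDiffOn.congr h fun x hx => by rw [h' x hx]

variable [∀ x, IsTopologicalAddGroup (V₂ x)] [∀ x, ContinuousSMul ℂ (V₂ x)]

theorem HolOn.apply {U : Set M} {Φ : Π x, V₁ x →L[ℂ] V₂ x} {s : Π x, V₁ x}
    (hΦ : HolOn E (F₁ →L[ℂ] F₂) U Φ) (hs : HolOn E F₁ U s) :
    HolOn E F₂ U (fun x => Φ x (s x)) :=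
  ContMDiffOn.clm_bundle_apply hΦ hs

theorem contMDiffAt_clm_of_apply [FiniteDimensional ℂ F₁] {f : M → F₁ →L[ℂ] F₂} {x₀ : M}
    (h : ∀ v, ContMDiffAt 𝓘(ℂ, E) 𝓘(ℂ, F₂) ω (fun x => f x v) x₀) :
    ContMDiffAt 𝓘(ℂ, E) 𝓘(ℂ, F₁ →L[ℂ] F₂) ω f x₀ := by
  let b := Module.finBasis ℂ F₁
  have : f = fun x => ∑ i, ContinuousLinearMap.smulRightL ℂ F₁ F₂
      (LinearMap.toContinuousLinearMap (b.coord i)) (f x (b i)) := by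
    funext x
    apply ContinuousLinearMap.coe_injective
    refine b.ext fun j => ?_
    simp [Finsupp.single_apply]
  rw [this]
  refine contMDiffAt_finsetSum fun i _ => ?_
  exact (ContinuousLinearMap.contMDiff _).contMDiffAt.comp x₀ (h (b i))

/-- A family of fibrewise linear maps is holomorphic if it maps local holomorphic sections to
holomorphic sections. -/
theorem holOn_hom [FiniteDimensional ℂ F₁] [IsManifold 𝓘(ℂ, E) ω M]
    [ContMDiffVectorBundle ω F₁ V₁ 𝓘(ℂ, E)] [ContMDiffVectorBundle ω F₂ V₂ 𝓘(ℂ, E)]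
    {U : Set M} (hU : IsOpen U) {Φ : Π x, V₁ x →L[ℂ] V₂ x}
    (h : ∀ W ⊆ U, IsOpen W → ∀ s : Π x, V₁ x, HolOn E F₁ W s → HolOn E F₂ W (fun x => Φ x (s x))) :
    HolOn E (F₁ →L[ℂ] F₂) U Φ := by
  intro x₀ hx₀
  apply ContMDiffAt.contMDiffWithinAt
  rw [contMDiffAt_hom_bundle]
  refine ⟨contMDiffAt_id, contMDiffAt_clm_of_apply fun v => ?_⟩
  set e := trivializationAt F₁ V₁ x₀
  set e' := trivializationAt F₂ V₂ x₀
  have hxe : x₀ ∈ e.baseSet := mem_baseSet_trivializationAt F₁ V₁ x₀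
  have hxe' : x₀ ∈ e'.baseSet := mem_baseSet_trivializationAt F₂ V₂ x₀
  have h1 : HolOn E F₁ (U ∩ e.baseSet) (fun x => e.symmL ℂ x v) := by
    intro x hx
    rw [e.contMDiffWithinAt_section _ hx.2]
    refine (contMDiffWithinAt_const (c := v)).congr (fun y hy => ?_) ?_
    · simp [e.symmL_apply hy.2, e.apply_mk_symm hy.2]
    · simp [e.symmL_apply hx.2, e.apply_mk_symm hx.2]
  have h2 := h _ inter_subset_left (hU.inter e.open_baseSet) _ h1
  have h3 : ContMDiffAt _ _ _ _ x₀ :=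
    h2.contMDiffAt ((hU.inter e.open_baseSet).mem_nhds ⟨hx₀, hxe⟩)
  rw [contMDiffAt_section] at h3
  refine h3.congr_of_eventuallyEq ?_
  filter_upwards [e.open_baseSet.mem_nhds hxe, e'.open_baseSet.mem_nhds hxe'] with x hx hx'
  change (e'.continuousLinearMapAt ℂ x (Φ x (e.symmL ℂ x v))) = _
  rw [e'.continuousLinearMapAt_apply ℂ, e'.coe_linearMapAt_of_mem hx']

theorem HolOn.isInvertible_of_injective [FiniteDimensional ℂ F₁] [FiniteDimensional ℂ F₂]
    (hd : Module.finrank ℂ F₁ = Module.finrank ℂ F₂) (x : M) (φ : V₁ x →L[ℂ] V₂ x)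
    (h : Function.Injective φ) : φ.IsInvertible := by
  let e₁ := (trivializationAt F₁ V₁ x).continuousLinearEquivAt ℂ x (mem_baseSet_trivializationAt F₁ V₁ x)
  let e₂ := (trivializationAt F₂ V₂ x).continuousLinearEquivAt ℂ x (mem_baseSet_trivializationAt F₂ V₂ x)
  let ψ : F₁ →L[ℂ] F₂ := (e₂ : V₂ x →L[ℂ] F₂) ∘L φ ∘L (e₁.symm : F₁ →L[ℂ] V₁ x)
  have hψ : Function.Injective ψ := e₂.injective.comp (h.comp e₁.symm.injective)
  let ψ' : F₁ ≃L[ℂ] F₂ := (LinearEquiv.ofInjectiveOfFinrankEq ψ.toLinearMap hψ hd).toContinuousLinearEquiv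
  refine ⟨e₁.trans (ψ'.trans e₂.symm), ?_⟩
  ext v
  have : ψ' (e₁ v) = e₂ (φ v) := by
    show ψ (e₁ v) = _
    simp [ψ]
  simp [this]

theorem HolOn.inverse [∀ x, IsTopologicalAddGroup (V₁ x)] [∀ x, ContinuousSMul ℂ (V₁ x)]
    [FiniteDimensional ℂ F₁] {U : Set M} (hU : IsOpen U) {Φ : Π x, V₁ x →L[ℂ] V₂ x}
    (h : HolOn E (F₁ →L[ℂ] F₂) U Φ) (hi : ∀ x, (Φ x).IsInvertible) :
    HolOn E (F₂ →L[ℂ] F₁) U (fun x => (Φ x).inverse) := by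
  intro x₀ hx₀
  apply ContMDiffAt.contMDiffWithinAt
  have h0 : ContMDiffAt _ _ _ _ x₀ := h.contMDiffAt (hU.mem_nhds hx₀)
  rw [contMDiffAt_hom_bundle] at h0 ⊢
  refine ⟨contMDiffAt_id, ?_⟩
  have hx : x₀ ∈ (trivializationAt F₁ V₁ x₀).baseSet := mem_baseSet_trivializationAt F₁ V₁ x₀
  have hx' : x₀ ∈ (trivializationAt F₂ V₂ x₀).baseSet := mem_baseSet_trivializationAt F₂ V₂ x₀
  have h1 : ContMDiffAt 𝓘(ℂ, E) 𝓘(ℂ, F₂ →L[ℂ] F₁) ω (ContinuousLinearMap.inverse ∘ fun x =>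
      ContinuousLinearMap.inCoordinates F₁ V₁ F₂ V₂ x₀ x x₀ x (Φ x)) x₀ := by
    refine ContMDiffAt.comp x₀ (ContDiffAt.contMDiffAt ?_) h0.2
    apply ContinuousLinearMap.IsInvertible.contDiffAt_map_inverse
    rw [ContinuousLinearMap.inCoordinates_eq hx hx']
    exact ContinuousLinearMap.isInvertible_equiv.comp
      ((hi x₀).comp ContinuousLinearMap.isInvertible_equiv)
  refine h1.congr_of_eventuallyEq ?_
  filter_upwards [(trivializationAt F₁ V₁ x₀).open_baseSet.mem_nhds hx,
    (trivializationAt F₂ V₂ x₀).open_baseSet.mem_nhds hx'] with x hx hx'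
  simp only [Function.comp_apply]
  rw [ContinuousLinearMap.inCoordinates_eq hx hx', ContinuousLinearMap.inCoordinates_eq hx' hx]
  simp only [ContinuousLinearMap.inverse_equiv_comp, ContinuousLinearMap.inverse_comp_equiv,
    ContinuousLinearEquiv.symm_symm]
  rfl

end Bundles

section Differential

variable {E : Type*} [NormedAddCommGroup E] [NormedSpace ℂ E]
  {M : Type*} [TopologicalSpace M] [ChartedSpace E M]
  {G : Type*} [NormedAddCommGroup G] [NormedSpace ℂ G]

variable (E) in
/-- The differential `df(p) : T_pM → G` of a vector-valued function `f : M → G`. -/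
def dAt (f : M → G) (p : M) : TangentSpace 𝓘(ℂ, E) p →L[ℂ] G :=
  mfderiv 𝓘(ℂ, E) 𝓘(ℂ, G) f p

theorem dAt_congr {f g : M → G} {p : M} (h : f =ᶠ[𝓝 p] g) : dAt E f p = dAt E g p :=
  h.mfderiv_eq

theorem dAt_mul {R : Type*} [NormedRing R] [NormedAlgebra ℂ R] {f g : M → R} {p : M}
    (hf : ContMDiffAt 𝓘(ℂ, E) 𝓘(ℂ, R) ω f p) (hg : ContMDiffAt 𝓘(ℂ, E) 𝓘(ℂ, R) ω g p)
    (v : TangentSpace 𝓘(ℂ, E) p) :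
    dAt E (fun q => f q * g q) p v = f p * dAt E g p v + dAt E f p v * g p := by
  have h := (hf.mdifferentiableAt (by simp)).hasMFDerivAt.mul'
    (hg.mdifferentiableAt (by simp)).hasMFDerivAt
  have h' := h.mfderiv
  exact congrArg (fun φ : TangentSpace 𝓘(ℂ, E) p →L[ℂ] R => φ v) h'

theorem holOn_const_iff {U : Set M} {f : M → G} :
    HolOn E G (V := fun _ => G) U f ↔ ContMDiffOn 𝓘(ℂ, E) 𝓘(ℂ, G) ω f U :=
  forall₂_congr fun _ _ => contMDiffWithinAt_section

theorem holOn_dAt [IsManifold 𝓘(ℂ, E) ω M] {U : Set M} (hU : IsOpen U) {f : M → G}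
    (hf : ContMDiffOn 𝓘(ℂ, E) 𝓘(ℂ, G) ω f U) :
    HolOn E (E →L[ℂ] G) (V := fun p => TangentSpace 𝓘(ℂ, E) p →L[ℂ] G) U (dAt E f) := by
  have : IsManifold 𝓘(ℂ, E) 1 M := .of_le (n := ω) le_top
  intro x hx
  apply ContMDiffAt.contMDiffWithinAt
  rw [contMDiffAt_hom_bundle]
  refine ⟨contMDiffAt_id, ?_⟩
  have := ContMDiffAt.mfderiv_const (m := ω) (hf.contMDiffAt (hU.mem_nhds hx)) (by simp)
  convert! this using 2 with y
  ext v
  simp [inTangentCoordinates, ContinuousLinearMap.inCoordinates, dAt]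
  rfl

theorem contMDiffOn_dAt_apply [IsManifold 𝓘(ℂ, E) ω M] {U : Set M} (hU : IsOpen U) {f : M → G}
    (hf : ContMDiffOn 𝓘(ℂ, E) 𝓘(ℂ, G) ω f U) {v : Π p : M, TangentSpace 𝓘(ℂ, E) p}
    (hv : HolOn E E U v) : ContMDiffOn 𝓘(ℂ, E) 𝓘(ℂ, G) ω (fun p => dAt E f p (v p)) U :=
  holOn_const_iff.1 (HolOn.apply (holOn_dAt hU hf) hv)

end Differential

section Atiyah

variable (E : Type*) [NormedAddCommGroup E] [NormedSpace ℂ E]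
  {M : Type*} [TopologicalSpace M] [ChartedSpace E M]
  (G : Type*) [NormedAddCommGroup G] [NormedSpace ℂ G] (W : M → Type*)
  [TopologicalSpace (TotalSpace G W)] [∀ x, AddCommGroup (W x)] [∀ x, Module ℂ (W x)]
  [∀ x, TopologicalSpace (W x)] [FiberBundle G W] [VectorBundle ℂ G W]

/-- The cover of `M` by the domains of the preferred trivializations of `W`. -/
def trivCover : PointCover M where
  nhd x := ⟨(trivializationAt G W x).baseSet, (trivializationAt G W x).open_baseSet⟩
  mem_nhd x := mem_baseSet_trivializationAt G W x

/-- The transition functions `g_{xy}` of `W`: if `e_x` denotes the frame of `W` given by the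
trivialization at `x`, then `e_y = e_x · g_{xy}`. Equivalently `g_{xy}` turns the coordinates of a
vector with respect to `e_y` into those with respect to `e_x`. -/
def transition (x y p : M) : G →L[ℂ] G :=
  (trivializationAt G W y).coordChangeL ℂ (trivializationAt G W x) p

theorem transition_apply {x y p : M} (hx : p ∈ (trivializationAt G W x).baseSet)
    (hy : p ∈ (trivializationAt G W y).baseSet) (v : G) :
    transition G W x y p v = (trivializationAt G W x).continuousLinearMapAt ℂ p
      ((trivializationAt G W y).symmL ℂ p v) := by
  rw [transition, ContinuousLinearEquiv.coe_coe, Trivialization.coordChangeL_apply _ _ ⟨hy, hx⟩,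
    Trivialization.continuousLinearMapAt_apply, Trivialization.coe_linearMapAt_of_mem _ hx,
    Trivialization.symmL_apply _ hy]

theorem transition_self {x p : M} (hx : p ∈ (trivializationAt G W x).baseSet) :
    transition G W x x p = 1 := by
  ext v
  rw [transition_apply G W hx hx, Trivialization.continuousLinearMapAt_symmL _ hx]
  rfl

theorem transition_mul {x y z p : M} (hx : p ∈ (trivializationAt G W x).baseSet)
    (hy : p ∈ (trivializationAt G W y).baseSet) (hz : p ∈ (trivializationAt G W z).baseSet) :
    transition G W x y p * transition G W y z p = transition G W x z p := by
  ext v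
  rw [mul_apply_eq_comp, transition_apply G W hy hz, transition_apply G W hx hy,
    transition_apply G W hx hz, Trivialization.symmL_continuousLinearMapAt _ hy]

theorem contMDiffOn_transition [ContMDiffVectorBundle ω G W 𝓘(ℂ, E)] (x y : M) :
    ContMDiffOn 𝓘(ℂ, E) 𝓘(ℂ, G →L[ℂ] G) ω (transition G W x y)
      ((trivializationAt G W x).baseSet ∩ (trivializationAt G W y).baseSet) :=
  (contMDiffOn_coordChangeL (IB := 𝓘(ℂ, E)) (trivializationAt G W y)
    (trivializationAt G W x)).mono (inter_comm _ _).subset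

theorem HolOn.symmL [ContMDiffVectorBundle ω G W 𝓘(ℂ, E)] {U : Set M} (x : M)
    (hU : U ⊆ (trivializationAt G W x).baseSet) {f : M → G}
    (hf : ContMDiffOn 𝓘(ℂ, E) 𝓘(ℂ, G) ω f U) :
    HolOn E G U (fun p => (trivializationAt G W x).symmL ℂ p (f p)) := by
  intro p hp
  rw [(trivializationAt G W x).contMDiffWithinAt_section _ (hU hp)]
  refine (hf p hp).congr (fun q hq => ?_) ?_
  · rw [Trivialization.symmL_apply _ (hU hq), Trivialization.apply_mk_symm _ (hU hq)]
  · rw [Trivialization.symmL_apply _ (hU hp), Trivialization.apply_mk_symm _ (hU hp)]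

theorem HolOn.continuousLinearMapAt [ContMDiffVectorBundle ω G W 𝓘(ℂ, E)] {U : Set M} (x : M)
    (hU : U ⊆ (trivializationAt G W x).baseSet) {s : Π p, W p} (hs : HolOn E G U s) :
    ContMDiffOn 𝓘(ℂ, E) 𝓘(ℂ, G) ω
      (fun p => (trivializationAt G W x).continuousLinearMapAt ℂ p (s p)) U := by
  intro p hp
  refine (((trivializationAt G W x).contMDiffWithinAt_section _ (hU hp)).1 (hs p hp)).congr
    (fun q hq => ?_) ?_
  · rw [Trivialization.continuousLinearMapAt_apply, Trivialization.coe_linearMapAt_of_mem _ (hU hq)]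
  · rw [Trivialization.continuousLinearMapAt_apply, Trivialization.coe_linearMapAt_of_mem _ (hU hp)]

variable [∀ x, IsTopologicalAddGroup (W x)] [∀ x, ContinuousSMul ℂ (W x)]

/-- The tensor `(1 / 2πi) ∑ dg_{xy}^{jl} ⊗ e_x^j ⊗ e_y^{l*}` with values in `Ω¹ ⊗ End W`, written as
the map sending a tangent vector `v` to the endomorphism of the fibre `W p` which takes
`∑ c_l e_y^l` to `(1 / 2πi) ∑ (dg_{xy}^{jl} v) c_l e_x^j`. -/
def atiyahForm (x y p : M) : TangentSpace 𝓘(ℂ, E) p →L[ℂ] W p →L[ℂ] W p :=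
  (2 * Real.pi * Complex.I : ℂ)⁻¹ •
    ((((trivializationAt G W x).symmL ℂ p).postcomp (W p)) ∘L
      (((trivializationAt G W y).continuousLinearMapAt ℂ p).precomp G) ∘L
        dAt E (transition G W x y) p)

theorem atiyahForm_apply (x y p : M) (v : TangentSpace 𝓘(ℂ, E) p) (w : W p) :
    atiyahForm E G W x y p v w = (2 * Real.pi * Complex.I : ℂ)⁻¹ •
      (trivializationAt G W x).symmL ℂ p (dAt E (transition G W x y) p v
        ((trivializationAt G W y).continuousLinearMapAt ℂ p w)) := rfl

theorem atiyahForm_cocycle [ContMDiffVectorBundle ω G W 𝓘(ℂ, E)] {x y z p : M}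
    (hx : p ∈ (trivializationAt G W x).baseSet)
    (hy : p ∈ (trivializationAt G W y).baseSet) (hz : p ∈ (trivializationAt G W z).baseSet) :
    atiyahForm E G W y z p - atiyahForm E G W x z p + atiyahForm E G W x y p = 0 := by
  ext v w
  have hxy : ContMDiffAt 𝓘(ℂ, E) 𝓘(ℂ, G →L[ℂ] G) ω (transition G W x y) p :=
    (contMDiffOn_transition E G W x y).contMDiffAt
      (((trivializationAt G W x).open_baseSet.inter
        (trivializationAt G W y).open_baseSet).mem_nhds ⟨hx, hy⟩)
  have hyz : ContMDiffAt 𝓘(ℂ, E) 𝓘(ℂ, G →L[ℂ] G) ω (transition G W y z) p :=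
    (contMDiffOn_transition E G W y z).contMDiffAt
      (((trivializationAt G W y).open_baseSet.inter
        (trivializationAt G W z).open_baseSet).mem_nhds ⟨hy, hz⟩)
  have h1 : dAt E (transition G W x z) p v =
      transition G W x y p * dAt E (transition G W y z) p v +
      dAt E (transition G W x y) p v * transition G W y z p := by
    rw [← dAt_mul hxy hyz]
    congr 1
    apply dAt_congr
    filter_upwards [(trivializationAt G W x).open_baseSet.mem_nhds hx,
      (trivializationAt G W y).open_baseSet.mem_nhds hy,
      (trivializationAt G W z).open_baseSet.mem_nhds hz] with q h h' h''
    exact (transition_mul G W h h' h'').symm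
  simp only [add_apply, sub_apply, atiyahForm_apply, h1,
    mul_apply_eq_comp, map_add, transition_apply G W hx hy, transition_apply G W hy hz,
    Trivialization.symmL_continuousLinearMapAt _ hx, Trivialization.symmL_continuousLinearMapAt _ hz,
    smul_add, zero_apply]
  abel

theorem holOn_atiyahForm [FiniteDimensional ℂ E] [FiniteDimensional ℂ G] [IsManifold 𝓘(ℂ, E) ω M]
    [ContMDiffVectorBundle ω G W 𝓘(ℂ, E)] (x y : M) :
    HolOn E (E →L[ℂ] G →L[ℂ] G)
      ((trivializationAt G W x).baseSet ∩ (trivializationAt G W y).baseSet)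
      (atiyahForm E G W x y) := by
  have hO := (trivializationAt G W x).open_baseSet.inter (trivializationAt G W y).open_baseSet
  refine holOn_hom hO fun O hO' hOo v hv => holOn_hom hOo fun O' hO'' hOo' w hw => ?_
  have h2 := contMDiffOn_dAt_apply hOo' ((contMDiffOn_transition E G W x y).mono (hO''.trans hO'))
    (hv.mono hO'')
  have h3 := h2.clm_apply (hw.continuousLinearMapAt E G W y
    ((hO''.trans hO').trans inter_subset_right))
  exact (HolOn.symmL E G W x ((hO''.trans hO').trans inter_subset_left) h3).const_smul_section

end Atiyah

section AtiyahClass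

variable (E : Type*) [NormedAddCommGroup E] [NormedSpace ℂ E]
  {M : Type*} [TopologicalSpace M] [ChartedSpace E M]

section
variable [FiniteDimensional ℂ E] [IsManifold 𝓘(ℂ, E) ω M]
  (G : Type*) [NormedAddCommGroup G] [NormedSpace ℂ G] [FiniteDimensional ℂ G]
  (W : M → Type*)
  [TopologicalSpace (TotalSpace G W)] [∀ x, AddCommGroup (W x)] [∀ x, Module ℂ (W x)]
  [∀ x, TopologicalSpace (W x)] [FiberBundle G W] [VectorBundle ℂ G W]
  [ContMDiffVectorBundle ω G W 𝓘(ℂ, E)]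
  [∀ x, IsTopologicalAddGroup (W x)] [∀ x, ContinuousSMul ℂ (W x)]

instance (p : M) : AddCommGroup (TangentSpace 𝓘(ℂ, E) p →L[ℂ] W p →L[ℂ] W p) := inferInstance
instance (p : M) : Module ℂ (TangentSpace 𝓘(ℂ, E) p →L[ℂ] W p →L[ℂ] W p) := inferInstance

/-- The sheaf `Ω¹ ⊗ End W` of holomorphic 1-forms with values in `End W`. -/
abbrev endFormSheaf :
    SectionPresheaf (fun p : M => TangentSpace 𝓘(ℂ, E) p →L[ℂ] W p →L[ℂ] W p) :=
  holSections E (E →L[ℂ] G →L[ℂ] G) (fun p : M => TangentSpace 𝓘(ℂ, E) p →L[ℂ] W p →L[ℂ] W p)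

/-- The Čech cocycle `a(W)_{xy} = (1 / 2πi) ∑ dg_{xy}^{jl} ⊗ e_x^j ⊗ e_y^{l*}`. -/
def atiyahCocycle : (endFormSheaf E G W).Z1 (trivCover G W) :=
  ⟨fun x y => ⟨fun p => atiyahForm E G W x y p,
      ⟨atiyahForm E G W x y, holOn_atiyahForm E G W x y, fun _ => rfl⟩⟩, by
    change (endFormSheaf E G W).d1 _ _ = 0
    funext x y z
    exact Subtype.ext (funext fun p => atiyahForm_cocycle E G W p.2.1.1 p.2.1.2 p.2.2)⟩

/-- The class `a(W) ∈ H¹(M, End W ⊗ Ω¹)`, i.e. `-1 / 2πi` times the Atiyah class of the holomorphic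
vector bundle `W`. (The forms `dg_{xy}^{jl} ⊗ e_x^j ⊗ e_y^{l*}` are the differences `∇_x - ∇_y` of
the local connections `∇_x` with `∇_x e_x = 0`, that is, of local splittings of the jet sequence.) -/
def atiyahClass : (endFormSheaf E G W).H1 := (endFormSheaf E G W).cls (atiyahCocycle E G W)
end

/-- The sheaf `Ω¹` of holomorphic 1-forms on `M`. -/
abbrev formSheaf (M : Type*) [TopologicalSpace M] [ChartedSpace E M] [IsManifold 𝓘(ℂ, E) ω M] :
    SectionPresheaf (fun p : M => TangentSpace 𝓘(ℂ, E) p →L[ℂ] ℂ) :=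
  holSections E (E →L[ℂ] ℂ) (fun p : M => TangentSpace 𝓘(ℂ, E) p →L[ℂ] ℂ)

section LineBundle

variable (L : M → Type*)
  [TopologicalSpace (TotalSpace ℂ L)] [∀ x, AddCommGroup (L x)] [∀ x, Module ℂ (L x)]
  [∀ x, TopologicalSpace (L x)] [FiberBundle ℂ L] [VectorBundle ℂ ℂ L]

/-- The 1-form `(1 / 2πi) dg_{xy} / g_{xy}`, where `g_{xy}` are the transition functions of the line
bundle `L`. -/
def dlogForm (x y p : M) : TangentSpace 𝓘(ℂ, E) p →L[ℂ] ℂ :=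
  (2 * Real.pi * Complex.I : ℂ)⁻¹ • (transition ℂ L x y p 1)⁻¹ •
    dAt E (fun q => transition ℂ L x y q 1) p

theorem transition_one_mul {x y z p : M} (hx : p ∈ (trivializationAt ℂ L x).baseSet)
    (hy : p ∈ (trivializationAt ℂ L y).baseSet) (hz : p ∈ (trivializationAt ℂ L z).baseSet) :
    transition ℂ L x y p 1 * transition ℂ L y z p 1 = transition ℂ L x z p 1 := by
  rw [← transition_mul ℂ L hx hy hz, mul_apply_eq_comp]
  conv_rhs => rw [← mul_one (transition ℂ L y z p 1), ← smul_eq_mul, map_smul, smul_eq_mul, mul_comm]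

theorem transition_one_ne_zero (x y p : M) : transition ℂ L x y p 1 ≠ 0 := by
  unfold transition
  simp

theorem contMDiffOn_transition_one [ContMDiffVectorBundle ω ℂ L 𝓘(ℂ, E)] (x y : M) :
    ContMDiffOn 𝓘(ℂ, E) 𝓘(ℂ, ℂ) ω (fun q => transition ℂ L x y q 1)
      ((trivializationAt ℂ L x).baseSet ∩ (trivializationAt ℂ L y).baseSet) :=
  (contMDiffOn_transition E ℂ L x y).clm_apply contMDiffOn_const

theorem dlogForm_cocycle [ContMDiffVectorBundle ω ℂ L 𝓘(ℂ, E)] {x y z p : M}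
    (hx : p ∈ (trivializationAt ℂ L x).baseSet)
    (hy : p ∈ (trivializationAt ℂ L y).baseSet) (hz : p ∈ (trivializationAt ℂ L z).baseSet) :
    dlogForm E L y z p - dlogForm E L x z p + dlogForm E L x y p = 0 := by
  ext v
  have hxy := (contMDiffOn_transition_one E L x y).contMDiffAt
      (((trivializationAt ℂ L x).open_baseSet.inter
        (trivializationAt ℂ L y).open_baseSet).mem_nhds ⟨hx, hy⟩)
  have hyz := (contMDiffOn_transition_one E L y z).contMDiffAt
      (((trivializationAt ℂ L y).open_baseSet.inter
        (trivializationAt ℂ L z).open_baseSet).mem_nhds ⟨hy, hz⟩)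
  have h1 : dAt E (fun q => transition ℂ L x z q 1) p v =
      transition ℂ L x y p 1 * dAt E (fun q => transition ℂ L y z q 1) p v +
      dAt E (fun q => transition ℂ L x y q 1) p v * transition ℂ L y z p 1 := by
    rw [← dAt_mul hxy hyz]
    congr 1
    apply dAt_congr
    filter_upwards [(trivializationAt ℂ L x).open_baseSet.mem_nhds hx,
      (trivializationAt ℂ L y).open_baseSet.mem_nhds hy,
      (trivializationAt ℂ L z).open_baseSet.mem_nhds hz] with q h h' h''
    exact (transition_one_mul L h h' h'').symm
  have n1 := transition_one_ne_zero L x y p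
  have n2 := transition_one_ne_zero L y z p
  simp only [dlogForm, add_apply, sub_apply, smul_apply, zero_apply, smul_eq_mul, h1,
    ← transition_one_mul L hx hy hz]
  field_simp
  ring

theorem holOn_dlogForm [FiniteDimensional ℂ E] [IsManifold 𝓘(ℂ, E) ω M]
    [ContMDiffVectorBundle ω ℂ L 𝓘(ℂ, E)] (x y : M) :
    HolOn E (E →L[ℂ] ℂ) ((trivializationAt ℂ L x).baseSet ∩ (trivializationAt ℂ L y).baseSet)
      (dlogForm E L x y) := by
  have hO := (trivializationAt ℂ L x).open_baseSet.inter (trivializationAt ℂ L y).open_baseSet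
  refine holOn_hom hO fun O hO' hOo v hv => holOn_const_iff.2 ?_
  have h1 := (contMDiffOn_transition_one E L x y).mono hO'
  have h2 := contMDiffOn_dAt_apply hOo h1 hv
  have h3 : ContMDiffOn 𝓘(ℂ, E) 𝓘(ℂ, ℂ) ω (fun p => (transition ℂ L x y p 1)⁻¹) O :=
    h1.inv₀ fun q _ => transition_one_ne_zero L x y q
  have h4 : ContMDiffOn 𝓘(ℂ, E) 𝓘(ℂ, ℂ) ω (fun _ : M => (2 * Real.pi * Complex.I : ℂ)⁻¹) O :=
    contMDiffOn_const
  exact h4.smul (h3.smul h2)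

/-- The Čech cocycle `(1 / 2πi) dlog g_{xy}` of a holomorphic line bundle. -/
def chernCocycle [FiniteDimensional ℂ E] [IsManifold 𝓘(ℂ, E) ω M]
    [ContMDiffVectorBundle ω ℂ L 𝓘(ℂ, E)] : (formSheaf E M).Z1 (trivCover ℂ L) :=
  ⟨fun x y => ⟨fun p => dlogForm E L x y p,
      ⟨dlogForm E L x y, holOn_dlogForm E L x y, fun _ => rfl⟩⟩, by
    change (formSheaf E M).d1 _ _ = 0
    funext x y z
    exact Subtype.ext (funext fun p => dlogForm_cocycle E L p.2.1.1 p.2.1.2 p.2.2)⟩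

/-- The first Chern class `c₁(L) ∈ H¹(M, Ω¹)` of a holomorphic line bundle. -/
def firstChern [FiniteDimensional ℂ E] [IsManifold 𝓘(ℂ, E) ω M]
    [ContMDiffVectorBundle ω ℂ L 𝓘(ℂ, E)] : (formSheaf E M).H1 :=
  (formSheaf E M).cls (chernCocycle E L)

end LineBundle
end AtiyahClass

section Determinant

theorem contDiff_clm_det (G : Type*) [NormedAddCommGroup G] [NormedSpace ℂ G]
    [FiniteDimensional ℂ G] : ContDiff ℂ ω (fun f : G →L[ℂ] G => f.det) := by
  let b := Module.finBasis ℂ G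
  have : (fun f : G →L[ℂ] G => f.det) = fun f =>
      ∑ σ : Equiv.Perm (Fin (Module.finrank ℂ G)), Equiv.Perm.sign σ •
        ∏ i, LinearMap.toContinuousLinearMap (b.coord (σ i)) (f (b i)) := by
    funext f
    change LinearMap.det f.toLinearMap = _
    rw [← LinearMap.det_toMatrix b, Matrix.det_apply]
    simp [LinearMap.toMatrix_apply]
  rw [this]
  refine ContDiff.sum fun σ _ => ?_
  simp only [Units.smul_def]
  refine ContDiff.const_smul _ (contDiff_prod fun i _ => ?_)
  exact (ContinuousLinearMap.contDiff _).comp (contDiff_id.clm_apply contDiff_const)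

variable {M : Type*} [TopologicalSpace M]
  (G : Type*) [NormedAddCommGroup G] [NormedSpace ℂ G] [FiniteDimensional ℂ G] (W : M → Type*)
  [TopologicalSpace (TotalSpace G W)] [∀ x, AddCommGroup (W x)] [∀ x, Module ℂ (W x)]
  [∀ x, TopologicalSpace (W x)] [FiberBundle G W] [VectorBundle ℂ G W]

/-- The determinant line bundle `det W` of a vector bundle `W`: the line bundle with
transition functions `det g_{xy}`, where `g_{xy}` are the transition functions of `W`. -/
def detBundle : VectorBundleCore ℂ M ℂ M where
  baseSet x := (trivializationAt G W x).baseSet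
  isOpen_baseSet x := (trivializationAt G W x).open_baseSet
  indexAt x := x
  mem_baseSet_at x := mem_baseSet_trivializationAt G W x
  coordChange y x p := (transition G W x y p).det • ContinuousLinearMap.id ℂ ℂ
  coordChange_self x p hp v := by simp [transition_self G W hp, ContinuousLinearMap.det]
  continuousOn_coordChange y x := by
    have h : ContinuousOn (fun p => (transition G W x y p).det)
        ((trivializationAt G W y).baseSet ∩ (trivializationAt G W x).baseSet) :=
      (contDiff_clm_det G).continuous.comp_continuousOn
        (VectorBundle.continuousOn_coordChange' (trivializationAt G W y) (trivializationAt G W x))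
    exact h.smul continuousOn_const
  coordChange_comp z y x p hp v := by
    have h : (transition G W x z p).det = (transition G W x y p).det * (transition G W y z p).det := by
      rw [← transition_mul G W hp.2 hp.1.2 hp.1.1]
      exact LinearMap.det_comp _ _
    simp [h, mul_assoc]

instance (E : Type*) [NormedAddCommGroup E] [NormedSpace ℂ E] [ChartedSpace E M]
    [ContMDiffVectorBundle ω G W 𝓘(ℂ, E)] : (detBundle G W).IsContMDiff 𝓘(ℂ, E) ω where
  contMDiffOn_coordChange y x := by
    have h : ContMDiffOn 𝓘(ℂ, E) 𝓘(ℂ, ℂ) ω (fun p => (transition G W x y p).det)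
        ((trivializationAt G W y).baseSet ∩ (trivializationAt G W x).baseSet) :=
      ContMDiff.comp_contMDiffOn (g := fun f : G →L[ℂ] G => f.det) (contDiff_clm_det G).contMDiff
        ((contMDiffOn_transition E G W x y).mono (inter_comm _ _).subset)
    exact h.smul contMDiffOn_const

end Determinant

theorem HolOn.mono {E : Type*} [NormedAddCommGroup E] [NormedSpace ℂ E]
    {M : Type*} [TopologicalSpace M] [ChartedSpace E M]
    {F : Type*} [NormedAddCommGroup F] [NormedSpace ℂ F] {V : M → Type*}
    [TopologicalSpace (TotalSpace F V)] [∀ x, TopologicalSpace (V x)] [FiberBundle F V]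
    {U W : Set M} {s : Π x, V x} (h : HolOn E F U s) (hW : W ⊆ U) : HolOn E F W s :=
  ContMDiffOn.mono h hW

section Covectors

/-- The dual `T*` of `T`. -/
def Covector (T : Type*) [AddCommGroup T] [Module ℂ T] [TopologicalSpace T] : Type _ := T →L[ℂ] ℂ

variable (T : Type*) [AddCommGroup T] [Module ℂ T] [TopologicalSpace T]

instance : AddCommGroup (Covector T) := inferInstanceAs (AddCommGroup (T →L[ℂ] ℂ))
instance : Module ℂ (Covector T) := inferInstanceAs (Module ℂ (T →L[ℂ] ℂ))
instance : FunLike (Covector T) T ℂ := inferInstanceAs (FunLike (T →L[ℂ] ℂ) T ℂ)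
instance : ContinuousLinearMapClass (Covector T) ℂ T ℂ :=
  inferInstanceAs (ContinuousLinearMapClass (T →L[ℂ] ℂ) ℂ T ℂ)
instance : TopologicalSpace (Covector T) := inferInstanceAs (TopologicalSpace (T →L[ℂ] ℂ))
instance : IsTopologicalAddGroup (Covector T) :=
  inferInstanceAs (IsTopologicalAddGroup (T →L[ℂ] ℂ))
instance [ContinuousSMul ℂ T] : ContinuousSMul ℂ (Covector T) :=
  inferInstanceAs (ContinuousSMul ℂ (T →L[ℂ] ℂ))

/-- The dual of a normed space, with the dual norm. -/
def CovectorModel (F : Type*) [NormedAddCommGroup F] [NormedSpace ℂ F] : Type _ := F →L[ℂ] ℂ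

variable (F : Type*) [NormedAddCommGroup F] [NormedSpace ℂ F]

instance : NormedAddCommGroup (CovectorModel F) := inferInstanceAs (NormedAddCommGroup (F →L[ℂ] ℂ))
instance : NormedSpace ℂ (CovectorModel F) := inferInstanceAs (NormedSpace ℂ (F →L[ℂ] ℂ))
instance [FiniteDimensional ℂ F] : FiniteDimensional ℂ (CovectorModel F) :=
  inferInstanceAs (FiniteDimensional ℂ (F →L[ℂ] ℂ))

variable (E : Type*) [NormedAddCommGroup E] [NormedSpace ℂ E]
  {M : Type*} [TopologicalSpace M] [ChartedSpace E M]

/-- The cotangent bundle `Ω¹_M`. -/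
abbrev Cotangent (p : M) : Type _ := Covector (TangentSpace 𝓘(ℂ, E) p)

variable [IsManifold 𝓘(ℂ, E) ω M]

instance : TopologicalSpace (TotalSpace (CovectorModel E) fun p : M => Cotangent E p) :=
  inferInstanceAs (TopologicalSpace
    (TotalSpace (E →L[ℂ] ℂ) fun p : M => TangentSpace 𝓘(ℂ, E) p →L[ℂ] ℂ))
instance : FiberBundle (CovectorModel E) fun p : M => Cotangent E p :=
  inferInstanceAs (FiberBundle (E →L[ℂ] ℂ) fun p : M => TangentSpace 𝓘(ℂ, E) p →L[ℂ] ℂ)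
instance : VectorBundle ℂ (CovectorModel E) fun p : M => Cotangent E p :=
  inferInstanceAs (VectorBundle ℂ (E →L[ℂ] ℂ) fun p : M => TangentSpace 𝓘(ℂ, E) p →L[ℂ] ℂ)
instance : ContMDiffVectorBundle ω (CovectorModel E) (fun p : M => Cotangent E p) 𝓘(ℂ, E) :=
  inferInstanceAs (ContMDiffVectorBundle ω (E →L[ℂ] ℂ)
    (fun p : M => TangentSpace 𝓘(ℂ, E) p →L[ℂ] ℂ) 𝓘(ℂ, E))

end Covectors

section FibrewiseTensors

variable (T : Type*) [AddCommGroup T] [Module ℂ T] [TopologicalSpace T] [IsTopologicalAddGroup T]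
  [ContinuousSMul ℂ T] [T2Space T] [FiniteDimensional ℂ T]

variable {T} in
/-- The transpose `λ ↦ λ ∘ f` of a linear map. -/
def transposeMap (f : T →L[ℂ] T) : Covector T →L[ℂ] Covector T := f.precomp ℂ

/-- The map `B ↦ (v ↦ (λ ↦ λ ∘ B(v, ·)))`, identifying `T* ⊗ (T* ⊗ T)` with `T* ⊗ End T*`. -/
def bilinMap : (T →L[ℂ] T →L[ℂ] T) →ₗ[ℂ] (T →L[ℂ] Covector T →L[ℂ] Covector T) where
  toFun B := LinearMap.toContinuousLinearMap
    { toFun := fun v => transposeMap (B v)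
      map_add' := fun v w => ContinuousLinearMap.ext fun l => ContinuousLinearMap.ext fun u => by
        change l (B (v + w) u) = l (B v u) + l (B w u)
        rw [map_add]
        exact map_add l _ _
      map_smul' := fun c v => ContinuousLinearMap.ext fun l => ContinuousLinearMap.ext fun u => by
        change l (B (c • v) u) = c • l (B v u)
        rw [map_smul]
        exact map_smul l _ _ }
  map_add' B C := ContinuousLinearMap.ext fun v => ContinuousLinearMap.ext fun l =>
    ContinuousLinearMap.ext fun u => map_add l _ _
  map_smul' c B := ContinuousLinearMap.ext fun v => ContinuousLinearMap.ext fun l =>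
    ContinuousLinearMap.ext fun u => map_smul l _ _

/-- The map `T* → T* ⊗ End T*`, `ξ ↦ id ⊗ ξ`, that is `v ↦ ξ(v) · id`. -/
def idTensorMap : (T →L[ℂ] ℂ) →ₗ[ℂ] (T →L[ℂ] Covector T →L[ℂ] Covector T) where
  toFun ξ := ξ.smulRight (ContinuousLinearMap.id ℂ (Covector T))
  map_add' ξ η := ContinuousLinearMap.ext fun v => add_smul (ξ v) (η v) _
  map_smul' c ξ := ContinuousLinearMap.ext fun v => mul_smul c (ξ v) _

/-- The map `T* → T* ⊗ End T*`, `ξ ↦ ξ ⊗ id`, that is `v ↦ (λ ↦ λ(v) · ξ)`. -/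
def tensorIdMap : (T →L[ℂ] ℂ) →ₗ[ℂ] (T →L[ℂ] Covector T →L[ℂ] Covector T) where
  toFun ξ := LinearMap.toContinuousLinearMap
    { toFun := fun v => transposeMap (ξ.smulRight v)
      map_add' := fun v w => ContinuousLinearMap.ext fun l => ContinuousLinearMap.ext fun u => by
        change l (ξ u • (v + w)) = l (ξ u • v) + l (ξ u • w)
        rw [smul_add, map_add]
      map_smul' := fun c v => ContinuousLinearMap.ext fun l => ContinuousLinearMap.ext fun u => by
        change l (ξ u • c • v) = c • l (ξ u • v)
        rw [smul_comm, map_smul] }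
  map_add' ξ η := ContinuousLinearMap.ext fun v => ContinuousLinearMap.ext fun l =>
    ContinuousLinearMap.ext fun u => by
      change l ((ξ u + η u) • v) = l (ξ u • v) + l (η u • v)
      rw [add_smul, map_add]
  map_smul' c ξ := ContinuousLinearMap.ext fun v => ContinuousLinearMap.ext fun l =>
    ContinuousLinearMap.ext fun u => by
      change l ((c * ξ u) • v) = c • l (ξ u • v)
      rw [mul_smul, map_smul]

variable {T}

theorem bilinMap_apply (B : T →L[ℂ] T →L[ℂ] T) (v u : T) (l : Covector T) :
    bilinMap T B v l u = l (B v u) := rfl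

theorem idTensorMap_apply (ξ : T →L[ℂ] ℂ) (v u : T) (l : Covector T) :
    idTensorMap T ξ v l u = ξ v * l u := rfl

theorem tensorIdMap_apply (ξ : T →L[ℂ] ℂ) (v u : T) (l : Covector T) :
    tensorIdMap T ξ v l u = ξ u * l v := by
  change l (ξ u • v) = _
  rw [map_smul, smul_eq_mul]

end FibrewiseTensors


/-- The presheaf of those sections of `A` which take values in given subspaces `S x ⊆ V x`. -/
def SectionPresheaf.subsheaf {M : Type*} [TopologicalSpace M] {V : M → Type*}
    [∀ x, AddCommGroup (V x)] [∀ x, Module ℂ (V x)] (A : SectionPresheaf V)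
    (S : Π x, Submodule ℂ (V x)) : SectionPresheaf V where
  sections U := A.sections U ⊓ Submodule.pi univ (fun x : U => S x)
  restrict_mem h s hs := ⟨A.restrict_mem h s hs.1, fun x _ => hs.2 ⟨x, h x.2⟩ trivial⟩

/-- The symmetric bilinear maps `T × T → T`. -/
def symForms (T : Type*) [AddCommGroup T] [Module ℂ T] [TopologicalSpace T]
    [IsTopologicalAddGroup T] [ContinuousSMul ℂ T] : Submodule ℂ (T →L[ℂ] T →L[ℂ] T) where
  carrier := {B | ∀ u v, B u v = B v u}
  zero_mem' := fun _ _ => rfl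
  add_mem' := fun h h' u v => congrArg₂ (· + ·) (h u v) (h' u v)
  smul_mem' := fun c _ h u v => congrArg (c • ·) (h u v)

section Tensors

variable (E : Type*) [NormedAddCommGroup E] [NormedSpace ℂ E]
  (M : Type*) [TopologicalSpace M] [ChartedSpace E M] [IsManifold 𝓘(ℂ, E) ω M]

section
variable {M}
instance (p : M) : AddCommGroup (TangentSpace 𝓘(ℂ, E) p →L[ℂ] Cotangent E p →L[ℂ] Cotangent E p) :=
  inferInstance
instance (p : M) : Module ℂ (TangentSpace 𝓘(ℂ, E) p →L[ℂ] Cotangent E p →L[ℂ] Cotangent E p) :=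
  inferInstance
instance (p : M) : AddCommGroup
    (TangentSpace 𝓘(ℂ, E) p →L[ℂ] TangentSpace 𝓘(ℂ, E) p →L[ℂ] TangentSpace 𝓘(ℂ, E) p) :=
  inferInstance
instance (p : M) : Module ℂ
    (TangentSpace 𝓘(ℂ, E) p →L[ℂ] TangentSpace 𝓘(ℂ, E) p →L[ℂ] TangentSpace 𝓘(ℂ, E) p) :=
  inferInstance
end

/-- The sheaf `Ω¹ ⊗ Ω¹ ⊗ T_M` of holomorphic bilinear forms on the tangent bundle with values
in the tangent bundle. -/
def bilinSheaf : SectionPresheaf (fun p : M =>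
    TangentSpace 𝓘(ℂ, E) p →L[ℂ] TangentSpace 𝓘(ℂ, E) p →L[ℂ] TangentSpace 𝓘(ℂ, E) p) :=
  holSections E (E →L[ℂ] E →L[ℂ] E) _

/-- The sheaf `S²Ω¹ ⊗ T_M` of holomorphic symmetric bilinear forms on the tangent bundle with values
in the tangent bundle. -/
def symSheaf : SectionPresheaf (fun p : M =>
    TangentSpace 𝓘(ℂ, E) p →L[ℂ] TangentSpace 𝓘(ℂ, E) p →L[ℂ] TangentSpace 𝓘(ℂ, E) p) :=
  (bilinSheaf E M).subsheaf fun p => symForms (TangentSpace 𝓘(ℂ, E) p)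

variable [FiniteDimensional ℂ E]

/-- The sheaf `Ω¹ ⊗ End Ω¹`. -/
abbrev endCotangentSheaf := endFormSheaf E (CovectorModel E) (fun p : M => Cotangent E p)

variable {M} in
instance (p : M) : T2Space (TangentSpace 𝓘(ℂ, E) p) := inferInstanceAs (T2Space E)
variable {M} in
instance (p : M) : FiniteDimensional ℂ (TangentSpace 𝓘(ℂ, E) p) :=
  inferInstanceAs (FiniteDimensional ℂ E)

variable {M E} in
theorem holOn_covector_apply {U : Set M} {l : Π p : M, Cotangent E p}
    {u : Π p : M, TangentSpace 𝓘(ℂ, E) p} (hl : HolOn E (CovectorModel E) U l)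
    (hu : HolOn E E U u) : ContMDiffOn 𝓘(ℂ, E) 𝓘(ℂ, ℂ) ω (fun p => l p (u p)) U :=
  holOn_const_iff.1 (HolOn.apply (F₁ := E) (F₂ := ℂ) (V₂ := fun _ => ℂ) (Φ := l) hl hu)

variable {M E} in
theorem holOn_cotangent {U : Set M} (hU : IsOpen U) {l : Π p : M, Cotangent E p}
    (h : ∀ W ⊆ U, IsOpen W → ∀ u : Π p : M, TangentSpace 𝓘(ℂ, E) p, HolOn E E W u →
      ContMDiffOn 𝓘(ℂ, E) 𝓘(ℂ, ℂ) ω (fun p => l p (u p)) W) : HolOn E (CovectorModel E) U l :=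
  holOn_hom (F₁ := E) (F₂ := ℂ) (V₂ := fun _ => ℂ) (Φ := l) hU fun W hW hWo u hu =>
    holOn_const_iff.2 (h W hW hWo u hu)

variable {M E} in
theorem holOn_endCotangent {U : Set M} (hU : IsOpen U)
    {Φ : Π p : M, TangentSpace 𝓘(ℂ, E) p →L[ℂ] Cotangent E p →L[ℂ] Cotangent E p}
    (h : ∀ W ⊆ U, IsOpen W → ∀ (v u : Π p : M, TangentSpace 𝓘(ℂ, E) p) (l : Π p : M, Cotangent E p),
      HolOn E E W v → HolOn E E W u → HolOn E (CovectorModel E) W l →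
      ContMDiffOn 𝓘(ℂ, E) 𝓘(ℂ, ℂ) ω (fun p => Φ p (v p) (l p) (u p)) W) :
    HolOn E (E →L[ℂ] CovectorModel E →L[ℂ] CovectorModel E) U Φ := by
  refine holOn_hom hU fun W hW hWo v hv => holOn_hom hWo fun W' hW' hWo' l hl =>
    holOn_cotangent hWo' fun W'' hWc hWo'' u hu => ?_
  exact h W'' (hWc.trans (hW'.trans hW)) hWo'' v u l (hv.mono (hWc.trans hW')) hu (hl.mono hWc)

/-- The inclusion `S²Ω¹ ⊗ T_M ⊆ Ω¹ ⊗ (Ω¹ ⊗ T_M) = Ω¹ ⊗ End Ω¹`. It sends `B` to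
`v ↦ (λ ↦ λ ∘ B(v, ·))`. -/
def symInclusion : (symSheaf E M).Hom (endCotangentSheaf E M) where
  toFun p := bilinMap (TangentSpace 𝓘(ℂ, E) p)
  map_mem U s := by
    rintro ⟨⟨t, ht, hts⟩, -⟩
    refine ⟨fun p => bilinMap _ (t p), holOn_endCotangent U.2 fun W hW hWo v u l hv hu hl => ?_,
      fun p => congrArg _ (hts p)⟩
    have h1 := HolOn.apply (HolOn.apply (HolOn.mono ht hW) hv) hu
    have h2 := holOn_covector_apply hl h1
    exact h2

/-- The morphism `Ω¹ → Ω¹ ⊗ End Ω¹`, `ξ ↦ id ⊗ ξ`, that is `v ↦ ξ(v) · id`. -/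
def idTensor : (formSheaf E M).Hom (endCotangentSheaf E M) where
  toFun p := idTensorMap (TangentSpace 𝓘(ℂ, E) p)
  map_mem U s := by
    rintro ⟨t, ht, hts⟩
    refine ⟨fun p => idTensorMap _ (t p), holOn_endCotangent U.2 fun W hW hWo v u l hv hu hl => ?_,
      fun p => congrArg _ (hts p)⟩
    have h1 := holOn_const_iff.1 (HolOn.apply (HolOn.mono ht hW) hv)
    have h2 := h1.smul (holOn_covector_apply hl hu)
    exact h2

/-- The morphism `Ω¹ → Ω¹ ⊗ End Ω¹`, `ξ ↦ ξ ⊗ id`, that is `v ↦ (λ ↦ λ(v) · ξ)`. -/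
def tensorId : (formSheaf E M).Hom (endCotangentSheaf E M) where
  toFun p := tensorIdMap (TangentSpace 𝓘(ℂ, E) p)
  map_mem U s := by
    rintro ⟨t, ht, hts⟩
    refine ⟨fun p => tensorIdMap _ (t p), holOn_endCotangent U.2 fun W hW hWo v u l hv hu hl => ?_,
      fun p => congrArg _ (hts p)⟩
    have h1 := holOn_const_iff.1 (HolOn.apply (HolOn.mono ht hW) hu)
    exact (h1.smul (holOn_covector_apply hl hv)).congr fun p _ => tensorIdMap_apply _ _ _ _

end Tensors

section Conformal

variable (E : Type*) [NormedAddCommGroup E] [NormedSpace ℂ E]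
  {M : Type*} [TopologicalSpace M] [ChartedSpace E M] [IsManifold 𝓘(ℂ, E) ω M]
  (L : M → Type*)
  [TopologicalSpace (TotalSpace ℂ L)] [∀ x, AddCommGroup (L x)] [∀ x, Module ℂ (L x)]
  [∀ x, TopologicalSpace (L x)] [∀ x, IsTopologicalAddGroup (L x)] [∀ x, ContinuousSMul ℂ (L x)]
  [FiberBundle ℂ L] [VectorBundle ℂ ℂ L]

/-- A holomorphic conformal structure on `M` with values in the holomorphic line bundle `L`:
a nondegenerate holomorphic section of `S²Ω¹ ⊗ L`. -/
structure HolomorphicConformalStructure where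
  form : Π p : M, TangentSpace 𝓘(ℂ, E) p →L[ℂ] TangentSpace 𝓘(ℂ, E) p →L[ℂ] L p
  holomorphic : HolOn E (E →L[ℂ] E →L[ℂ] ℂ) univ form
  symm : ∀ p u v, form p u v = form p v u
  nondegenerate : ∀ p u, (∀ v, form p u v = 0) → u = 0

/-- The sheaf `T_M ⊗ L*` of holomorphic homomorphisms from `L` to the tangent bundle. -/
abbrev twistedTangentSheaf : SectionPresheaf (fun p : M => L p →L[ℂ] TangentSpace 𝓘(ℂ, E) p) :=
  holSections E (ℂ →L[ℂ] E) (fun p : M => L p →L[ℂ] TangentSpace 𝓘(ℂ, E) p)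

/-- The map `T* → Hom(L, Hom(T, L))` sending `ξ` to `l ↦ (v ↦ ξ(v) l)`. -/
def covectorTwist (T : Type*) [AddCommGroup T] [Module ℂ T] [TopologicalSpace T]
    (L : Type*) [AddCommGroup L] [Module ℂ L] [TopologicalSpace L] [IsTopologicalAddGroup L]
    [ContinuousSMul ℂ L] (ξ : T →L[ℂ] ℂ) : L →L[ℂ] (T →L[ℂ] L) :=
  (ξ.precomp L) ∘L (ContinuousLinearMap.toSpanSingletonCLE : L ≃L[ℂ] (ℂ →L[ℂ] L))

theorem covectorTwist_apply {T : Type*} [AddCommGroup T] [Module ℂ T] [TopologicalSpace T]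
    {L : Type*} [AddCommGroup L] [Module ℂ L] [TopologicalSpace L] [IsTopologicalAddGroup L]
    [ContinuousSMul ℂ L] (ξ : T →L[ℂ] ℂ) (l : L) (v : T) : covectorTwist T L ξ l v = ξ v • l := rfl

/-- For `B : T → Hom(T, L)` the map `ξ ↦ (l ↦ B⁻¹(ξ(·) l))`. -/
def sharpMap {T : Type*} [AddCommGroup T] [Module ℂ T] [TopologicalSpace T]
    [IsTopologicalAddGroup T] [ContinuousSMul ℂ T]
    {L : Type*} [AddCommGroup L] [Module ℂ L] [TopologicalSpace L] [IsTopologicalAddGroup L]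
    [ContinuousSMul ℂ L] (B : T →L[ℂ] T →L[ℂ] L) : (T →L[ℂ] ℂ) →ₗ[ℂ] (L →L[ℂ] T) where
  toFun ξ := B.inverse ∘L covectorTwist T L ξ
  map_add' ξ η := ContinuousLinearMap.ext fun l => by
    change B.inverse (covectorTwist T L (ξ + η) l) =
      B.inverse (covectorTwist T L ξ l) + B.inverse (covectorTwist T L η l)
    rw [← map_add]
    congr 1
    exact ContinuousLinearMap.ext fun v => add_smul (ξ v) (η v) l
  map_smul' c ξ := ContinuousLinearMap.ext fun l => by
    change B.inverse (covectorTwist T L (c • ξ) l) = c • B.inverse (covectorTwist T L ξ l)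
    rw [← map_smul]
    congr 1
    exact ContinuousLinearMap.ext fun v => mul_smul c (ξ v) l

/-- The map `φ ↦ B ⊗ φ`, where `L ⊗ L*` is contracted: `(B ⊗ φ)(u, v) = φ(B(u, v))`. -/
def tensorMap {T : Type*} [AddCommGroup T] [Module ℂ T] [TopologicalSpace T]
    [IsTopologicalAddGroup T] [ContinuousSMul ℂ T]
    {L : Type*} [AddCommGroup L] [Module ℂ L] [TopologicalSpace L] [IsTopologicalAddGroup L]
    [ContinuousSMul ℂ L] (B : T →L[ℂ] T →L[ℂ] L) : (L →L[ℂ] T) →ₗ[ℂ] (T →L[ℂ] T →L[ℂ] T) where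
  toFun φ := (φ.postcomp T) ∘L B
  map_add' _ _ := rfl
  map_smul' _ _ := rfl

namespace HolomorphicConformalStructure

variable {E L} (g : HolomorphicConformalStructure E L) [FiniteDimensional ℂ E]

theorem isInvertible (p : M) : (g.form p).IsInvertible := by
  refine HolOn.isInvertible_of_injective (F₁ := E) (F₂ := E →L[ℂ] ℂ)
    (V₁ := fun p : M => TangentSpace 𝓘(ℂ, E) p) (V₂ := fun p : M => TangentSpace 𝓘(ℂ, E) p →L[ℂ] L p) ?_ p _ ?_
  · rw [← (LinearMap.toContinuousLinearMap (𝕜 := ℂ) (E := E) (F' := ℂ)).finrank_eq]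
    exact (Subspace.dual_finrank_eq (K := ℂ) (V := E)).symm
  · rw [injective_iff_map_eq_zero]
    intro u hu
    exact g.nondegenerate p u fun v => by rw [hu]; rfl

/-- The defining property of `sharpMap`: `ω(φ(l), v) = ξ(v) l` for `φ = ω⁻¹(ξ)`. -/
theorem form_sharpMap (p : M) (ξ : TangentSpace 𝓘(ℂ, E) p →L[ℂ] ℂ) (l : L p)
    (v : TangentSpace 𝓘(ℂ, E) p) : g.form p (sharpMap (g.form p) ξ l) v = ξ v • l := by
  have h := (g.isInvertible p).self_apply_inverse (covectorTwist _ _ ξ l)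
  exact congrArg (fun f : TangentSpace 𝓘(ℂ, E) p →L[ℂ] L p => f v) h

variable [ContMDiffVectorBundle ω ℂ L 𝓘(ℂ, E)]

/-- `ω⁻¹ : Ω¹ → T_M ⊗ L*`, the inverse of the isomorphism `T_M ⊗ L* → Ω¹` induced by `ω`:
it sends the covector `ξ` to the homomorphism `φ : L → T_M` determined by
`ω(φ(l), v) = ξ(v) l`. -/
def sharp : (formSheaf E M).Hom (twistedTangentSheaf E L) where
  toFun p := sharpMap (g.form p)
  map_mem U s := by
    rintro ⟨t, ht, hts⟩
    refine ⟨fun p => sharpMap (g.form p) (t p), ?_, fun p => congrArg _ (hts p)⟩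
    have h0 : HolOn E ((E →L[ℂ] ℂ) →L[ℂ] E) U (fun p => (g.form p).inverse) :=
      HolOn.inverse U.2 (HolOn.mono g.holomorphic (subset_univ _)) g.isInvertible
    refine holOn_hom U.2 fun W hW hWo l hl => ?_
    have h2 : HolOn E (E →L[ℂ] ℂ) W (fun p => covectorTwist (TangentSpace 𝓘(ℂ, E) p) (L p)
        (t p) (l p)) := by
      refine holOn_hom hWo fun W' hW' hWo' v hv => ?_
      have h1 := holOn_const_iff.1 (HolOn.apply (HolOn.mono ht (hW'.trans hW)) hv)
      exact ContMDiffOn.smul_section h1 (hl.mono hW')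
    have h3 := HolOn.apply (HolOn.mono h0 hW) h2
    exact h3

/-- The morphism `T_M ⊗ L* → S²Ω¹ ⊗ T_M`, `φ ↦ ω ⊗ φ`, where `L ⊗ L*` is contracted:
`(ω ⊗ φ)(u, v) = φ(ω(u, v))`. -/
def tensor : (twistedTangentSheaf E L).Hom (symSheaf E M) where
  toFun p := tensorMap (g.form p)
  map_mem U s := by
    rintro ⟨t, ht, hts⟩
    refine ⟨⟨fun p => tensorMap (g.form p) (t p), ?_, fun p => congrArg _ (hts p)⟩,
      fun p _ u v => congrArg (s p) (g.symm p u v)⟩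
    refine holOn_hom U.2 fun W hW hWo u hu => holOn_hom hWo fun W' hW' hWo' v hv => ?_
    have h1 := HolOn.apply (HolOn.mono g.holomorphic (subset_univ _)) (HolOn.mono hu hW')
    have h2 := HolOn.apply h1 hv
    have h3 := HolOn.apply (HolOn.mono ht (hW'.trans hW)) h2
    exact h3

end HolomorphicConformalStructure

end Conformal

section Canonical

variable (E : Type*) [NormedAddCommGroup E] [NormedSpace ℂ E] [FiniteDimensional ℂ E]
  (M : Type*) [TopologicalSpace M] [ChartedSpace E M] [IsManifold 𝓘(ℂ, E) ω M]

/-- The canonical bundle `K_M = det Ω¹_M`. -/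
abbrev canonicalBundle : VectorBundleCore ℂ M ℂ M :=
  detBundle (CovectorModel E) (fun p : M => Cotangent E p)

/-- `H¹(M, Ω¹)`. -/
def H1Form : Type _ := (formSheaf E M).H1
instance : AddCommGroup (H1Form E M) := inferInstanceAs (AddCommGroup (formSheaf E M).H1)
instance : Module ℂ (H1Form E M) := inferInstanceAs (Module ℂ (formSheaf E M).H1)

/-- `H¹(M, Ω¹ ⊗ End Ω¹)`. -/
def H1EndCotangent : Type _ := (endCotangentSheaf E M).H1
instance : AddCommGroup (H1EndCotangent E M) :=
  inferInstanceAs (AddCommGroup (endCotangentSheaf E M).H1)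
instance : Module ℂ (H1EndCotangent E M) := inferInstanceAs (Module ℂ (endCotangentSheaf E M).H1)

/-- `H¹(M, S²Ω¹ ⊗ T_M)`. -/
def H1Sym : Type _ := (symSheaf E M).H1
instance : AddCommGroup (H1Sym E M) := inferInstanceAs (AddCommGroup (symSheaf E M).H1)
instance : Module ℂ (H1Sym E M) := inferInstanceAs (Module ℂ (symSheaf E M).H1)

/-- The first Chern class `c₁(K_M) ∈ H¹(M, Ω¹)` of the canonical bundle. -/
def canonicalClass : H1Form E M := firstChern E (canonicalBundle E M).Fiber

/-- The class `a(Ω¹_M) ∈ H¹(M, Ω¹ ⊗ End Ω¹)`. -/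
def atiyahClassCotangent : H1EndCotangent E M :=
  atiyahClass E (CovectorModel E) (fun p : M => Cotangent E p)

/-- The map `H¹(M, S²Ω¹ ⊗ T_M) → H¹(M, Ω¹ ⊗ End Ω¹)` induced by the inclusion of sheaves. -/
def symInclusionH1 : H1Sym E M →ₗ[ℂ] H1EndCotangent E M := (symInclusion E M).mapH1

/-- The map `H¹(M, Ω¹) → H¹(M, Ω¹ ⊗ End Ω¹)`, `ξ ↦ id ⊗ ξ`. -/
def idTensorH1 : H1Form E M →ₗ[ℂ] H1EndCotangent E M := (idTensor E M).mapH1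

/-- The map `H¹(M, Ω¹) → H¹(M, Ω¹ ⊗ End Ω¹)`, `ξ ↦ ξ ⊗ id`. -/
def tensorIdH1 : H1Form E M →ₗ[ℂ] H1EndCotangent E M := (tensorId E M).mapH1

variable {E M} in
/-- The map `H¹(M, Ω¹) → H¹(M, S²Ω¹ ⊗ T_M)`, `ξ ↦ ω ⊗ ω⁻¹(ξ)`. -/
def HolomorphicConformalStructure.tensorSharpH1 {L : M → Type*} [TopologicalSpace (TotalSpace ℂ L)]
    [∀ p, AddCommGroup (L p)] [∀ p, Module ℂ (L p)] [∀ p, TopologicalSpace (L p)]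
    [∀ p, IsTopologicalAddGroup (L p)] [∀ p, ContinuousSMul ℂ (L p)]
    [FiberBundle ℂ L] [VectorBundle ℂ ℂ L] [ContMDiffVectorBundle ω ℂ L 𝓘(ℂ, E)]
    (g : HolomorphicConformalStructure E L) : H1Form E M →ₗ[ℂ] H1Sym E M :=
  g.tensor.mapH1 ∘ₗ g.sharp.mapH1

end Canonical

end

/-! Near each point `x` fix a chart of `M` and a trivialization of `L`. The trivialization turns `ω`
into a genuine holomorphic metric `g_x`, with Levi-Civita connection `D_x`. The chart gives the flat
connection `d_x` on `T_M` whose parallel frame is the coordinate frame. Write `D_x = d_x + Γ_x`,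
with `Γ_x` given by Koszul's formula (`christoffel`). All these connections are torsion free, so
their differences and the `Γ_x` are sections of `S²Ω¹ ⊗ T_M`.

The cocycle `(d_y - d_x) / 2πi` represents `a(Ω¹)`: dualizing reverses the order of the two charts
(`atiyahForm_cotangent`). Concretely it is the Hessian of the coordinate change, which is symmetric
(`dAt_transition_tangent_symm`). Thus `a(Ω¹)` comes from the class of `hessianCocycle`. The map
induced on `H¹` by the inclusion of `S²Ω¹ ⊗ T_M` is injective because symmetrization splits the
inclusion.

If `m` is the transition function of `L`, then `g_x = m g_y`, and the Levi-Civita connections of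
conformal metrics satisfy `D_x - D_y = ½ (id ⊗ dlog m + dlog m ⊗ id - ω ⊗ ω⁻¹(dlog m))`. This is
`atiyahForm_eq_christoffel_sub`. The `Γ_x` form a 0-cochain, so passing to cohomology gives
`cls_hessianCocycle`: `a(Ω¹) = -½ (id ⊗ c₁(L) + c₁(L) ⊗ id) + ½ ω ⊗ ω⁻¹(c₁(L))`.

It remains to express `c₁(L)` through `c₁(K_M)`, which is done by taking the trace `S²Ω¹ ⊗ T_M → Ω¹`
of the same formula. The trace sends `a(Ω¹)` to `c₁(K_M)` by Jacobi's formula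
(`symTrace_hessianCocycle`), `id ⊗ ξ + ξ ⊗ id` to `(n + 1) ξ`, and `ω ⊗ ω⁻¹(ξ)` to `ξ`. Hence
`c₁(K_M) = -(n/2) c₁(L)`, and substitution finishes the proof. -/

noncomputable section

set_option synthInstance.maxHeartbeats 200000

/-! ### Čech classes: representatives and functoriality -/

namespace SectionPresheaf

variable {M : Type*} [TopologicalSpace M]
  {V : M → Type*} [∀ x, AddCommGroup (V x)] [∀ x, Module ℂ (V x)]
  {W : M → Type*} [∀ x, AddCommGroup (W x)] [∀ x, Module ℂ (W x)]
  {X : M → Type*} [∀ x, AddCommGroup (X x)] [∀ x, Module ℂ (X x)]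
  {A : SectionPresheaf V} {B : SectionPresheaf W} {C : SectionPresheaf X}
  {𝒰 𝒱 𝒲 : PointCover M}

-- Any two point covers have a common refinement, so the direct limit is over a directed set and
-- each class already lives on one cover. Identities between maps on `H¹` can then be checked on
-- cocycles.
open Classical in
theorem exists_cls_eq (c : A.H1) : ∃ (𝒰 : PointCover M) (f : A.Z1 𝒰), c = A.cls f := by
  have : Nonempty (PointCover M) := ⟨⟨fun _ => ⊤, fun _ => trivial⟩⟩
  -- The common refinement intersects, at each point, the two sets indexed by that point.
  have : IsDirectedOrder (PointCover M) := ⟨fun 𝒰 𝒱 =>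
    ⟨⟨fun x => 𝒰.nhd x ⊓ 𝒱.nhd x, fun x => ⟨𝒰.mem_nhd x, 𝒱.mem_nhd x⟩⟩,
      fun _ => inf_le_left, fun _ => inf_le_right⟩⟩
  obtain ⟨𝒰, z, rfl⟩ := Module.DirectLimit.exists_of (R := ℂ)
    (G := fun 𝒰 : PointCover M => A.coverH1 𝒰) (f := fun _ _ h => A.refineH1 h) c
  obtain ⟨f, rfl⟩ := (A.B1 𝒰).mkQ_surjective z
  exact ⟨𝒰, f, rfl⟩

open Classical in
theorem cls_add (f g : A.Z1 𝒰) : A.cls (f + g) = A.cls f + A.cls g := by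
  unfold cls
  rw [map_add]
  exact map_add (Module.DirectLimit.of ℂ (PointCover M) (fun 𝒰 => A.coverH1 𝒰)
    (fun _ _ h => A.refineH1 h) 𝒰) _ _

open Classical in
theorem cls_smul (c : ℂ) (f : A.Z1 𝒰) : A.cls (c • f) = c • A.cls f := by
  unfold cls
  rw [map_smul]
  exact map_smul (Module.DirectLimit.of ℂ (PointCover M) (fun 𝒰 => A.coverH1 𝒰)
    (fun _ _ h => A.refineH1 h) 𝒰) _ _

open Classical in
theorem cls_refineZ1 (h : 𝒰 ≤ 𝒱) (f : A.Z1 𝒰) : A.cls (A.refineZ1 h f) = A.cls f := by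
  exact Module.DirectLimit.of_f (R := ℂ) (G := fun 𝒰 : PointCover M => A.coverH1 𝒰)
    (f := fun _ _ h => A.refineH1 h) (hij := h) (x := (A.B1 𝒰).mkQ f)

open Classical in
theorem cls_eq_of_sub_eq_d0 {f g : A.Z1 𝒰} (b : A.C0 𝒰) (h : A.d0 𝒰 b = f.1 - g.1) :
    A.cls f = A.cls g := by
  have : (A.B1 𝒰).mkQ f = (A.B1 𝒰).mkQ g := (Submodule.Quotient.eq _).2 ⟨b, h⟩
  unfold cls
  rw [this]

open Classical in
theorem mapH1_cls (φ : A.Hom B) (f : A.Z1 𝒰) : φ.mapH1 (A.cls f) = B.cls (φ.mapZ1 𝒰 f) := by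
  exact Module.DirectLimit.map_apply_of (R := ℂ) (G := fun 𝒰 : PointCover M => A.coverH1 𝒰)
    (f := fun _ _ h => A.refineH1 h) (f' := fun _ _ h => B.refineH1 h)
    (fun 𝒰 => φ.mapCoverH1 𝒰) _ ((A.B1 𝒰).mkQ f)

/-- Two cocycles with the same values define the same class. -/
theorem cls_congr (h : ∀ x, 𝒱.nhd x = 𝒰.nhd x) {f : A.Z1 𝒰} {g : A.Z1 𝒱}
    (hfg : ∀ x y p, (hp : p ∈ 𝒰.nhd x ⊓ 𝒰.nhd y) → (hp' : p ∈ 𝒱.nhd x ⊓ 𝒱.nhd y) →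
      (f.1 x y).1 ⟨p, hp⟩ = (g.1 x y).1 ⟨p, hp'⟩) : A.cls f = A.cls g := by
  have h' : 𝒰 ≤ 𝒱 := fun x => (h x).le
  rw [← cls_refineZ1 h']
  congr 1
  refine Subtype.ext (funext fun x => funext fun y => Subtype.ext (funext fun p => ?_))
  exact hfg x y p _ p.2

/-- Agreement is required only on values of sections, not on whole fibres. For a subsheaf such as
`symSheaf` the fibrewise identity holds only on the subspace in which sections take values. -/
theorem mapH1_eq_comp {φ : A.Hom B} {ψ : B.Hom C} {χ : A.Hom C}
    (h : ∀ (U : Opens M) (s : Π x : U, V x), s ∈ A.sections U →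
      ∀ x : U, ψ.toFun x (φ.toFun x (s x)) = χ.toFun x (s x)) (c : A.H1) :
    ψ.mapH1 (φ.mapH1 c) = χ.mapH1 c := by
  obtain ⟨𝒰, f, rfl⟩ := exists_cls_eq c
  simp only [mapH1_cls]
  congr 1
  exact Subtype.ext (funext fun x => funext fun y => Subtype.ext (funext fun p =>
    h _ _ (f.1 x y).2 p))

/-- Multiplication by a scalar. -/
def Hom.scalar (A : SectionPresheaf V) (c : ℂ) : A.Hom A where
  toFun _ := c • LinearMap.id
  map_mem U _ hs := (A.sections U).smul_mem c hs

theorem Hom.scalar_mapH1 (c : ℂ) (a : A.H1) : (Hom.scalar A c).mapH1 a = c • a := by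
  obtain ⟨𝒰, f, rfl⟩ := exists_cls_eq a
  rw [mapH1_cls, ← cls_smul]
  rfl

end SectionPresheaf

/-! ### Jacobi's formula and the chain rule -/

section Calculus

/-- Jacobi's formula at the identity. -/
theorem fderiv_clm_det_one {G : Type*} [NormedAddCommGroup G] [NormedSpace ℂ G]
    [FiniteDimensional ℂ G] (X : G →L[ℂ] G) :
    fderiv ℂ (fun f : G →L[ℂ] G => f.det) 1 X = LinearMap.trace ℂ G X := by
  let b := Module.finBasis ℂ G
  -- Along the line `1 + t X` the determinant is a polynomial in `t`, whose linear coefficient is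
  -- the trace.
  let P : Polynomial ℂ := (1 + (Polynomial.X : Polynomial ℂ) •
    (LinearMap.toMatrix b b X.toLinearMap).map Polynomial.C).det
  have h1 : ∀ t : ℂ, (1 + t • X : G →L[ℂ] G).det = P.eval t := by
    intro t
    change LinearMap.det (1 + t • X : G →L[ℂ] G).toLinearMap = _
    rw [← LinearMap.det_toMatrix b]
    have h : P.eval t = (((1 + (Polynomial.X : Polynomial ℂ) •
        (LinearMap.toMatrix b b X.toLinearMap).map Polynomial.C)).map
          (Polynomial.evalRingHom t)).det := RingHom.map_det (Polynomial.evalRingHom t) _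
    rw [h]
    congr 1
    ext i j
    simp [Matrix.one_apply, LinearMap.toMatrix_apply, apply_ite, Finsupp.single_apply, eq_comm]
    exact mul_comm _ _
  have h2 : HasDerivAt (fun t : ℂ => (1 + t • X : G →L[ℂ] G).det)
      (fderiv ℂ (fun f : G →L[ℂ] G => f.det) 1 X) 0 := by
    have hf := ((contDiff_clm_det G).differentiable (by simp) (1 + (0 : ℂ) • X)).hasFDerivAt
    have hg : HasDerivAt (fun t : ℂ => (1 + t • X : G →L[ℂ] G)) X 0 := by
      simpa using ((hasDerivAt_id (0 : ℂ)).smul_const X).const_add 1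
    rw [zero_smul, add_zero] at hf
    exact hf.comp_hasDerivAt_of_eq 0 hg (by simp)
  have h3 := P.hasDerivAt 0
  simp only [h1] at h2
  rw [h2.unique h3, LinearMap.trace_eq_matrix_trace ℂ b, Matrix.derivative_det_one_add_X_smul]

/-- Jacobi's formula. -/
theorem fderiv_clm_det {G : Type*} [NormedAddCommGroup G] [NormedSpace ℂ G]
    [FiniteDimensional ℂ G] {A A' : G →L[ℂ] G} (h : A * A' = 1) (X : G →L[ℂ] G) :
    fderiv ℂ (fun f : G →L[ℂ] G => f.det) A X = A.det * LinearMap.trace ℂ G (A' * X : G →L[ℂ] G) := by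
  have hd := (contDiff_clm_det G).differentiable (n := ω) (by simp)
  have hmul : ∀ B C : G →L[ℂ] G, (B * C).det = B.det * C.det := fun B C => LinearMap.det_comp _ _
  -- Translation by `A'` moves the base point from `A` to the identity, where the formula is known.
  have h1 : (fun f : G →L[ℂ] G => f.det) = fun f => A.det * (A' * f).det := by
    funext f
    rw [← hmul, ← mul_assoc, h, one_mul]
  -- In finite dimension a one-sided inverse is two-sided.
  have h' : A' * A = 1 := by
    apply ContinuousLinearMap.coe_injective
    exact mul_eq_one_comm.1 (congrArg ContinuousLinearMap.toLinearMap h : A.toLinearMap * A'.toLinearMap = 1)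
  have h2 : HasFDerivAt (fun f : G →L[ℂ] G => A' * f) (ContinuousLinearMap.mul ℂ (G →L[ℂ] G) A') A :=
    (ContinuousLinearMap.mul ℂ (G →L[ℂ] G) A').hasFDerivAt
  have h3 := (hd (A' * A)).hasFDerivAt.comp A h2
  have h4 := (h3.const_mul A.det).fderiv
  rw [h1]
  refine (congrArg (fun φ : (G →L[ℂ] G) →L[ℂ] ℂ => φ X) h4).trans ?_
  change A.det * fderiv ℂ (fun f : G →L[ℂ] G => f.det) (A' * A) (A' * X) = _
  rw [h', fderiv_clm_det_one]

variable {E : Type*} [NormedAddCommGroup E] [NormedSpace ℂ E]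
  {M : Type*} [TopologicalSpace M] [ChartedSpace E M]
  {G : Type*} [NormedAddCommGroup G] [NormedSpace ℂ G]
  {G' : Type*} [NormedAddCommGroup G'] [NormedSpace ℂ G']

theorem dAt_comp {F : G → G'} {f : M → G} {p : M} (hF : DifferentiableAt ℂ F (f p))
    (hf : ContMDiffAt 𝓘(ℂ, E) 𝓘(ℂ, G) ω f p) (v : TangentSpace 𝓘(ℂ, E) p) :
    dAt E (fun q => F (f q)) p v = fderiv ℂ F (f p) (dAt E f p v) := by
  have h := mfderiv_comp p (g := F) (f := f) hF.mdifferentiableAt (hf.mdifferentiableAt (by simp))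
  rw [mfderiv_eq_fderiv] at h
  exact congrArg (fun φ : TangentSpace 𝓘(ℂ, E) p →L[ℂ] G' => φ v) h

theorem dAt_prodMk {f : M → G} {f' : M → G'} {p : M}
    (hf : ContMDiffAt 𝓘(ℂ, E) 𝓘(ℂ, G) ω f p)
    (hf' : ContMDiffAt 𝓘(ℂ, E) 𝓘(ℂ, G') ω f' p) (v : TangentSpace 𝓘(ℂ, E) p) :
    dAt E (fun q => (f q, f' q)) p v = (dAt E f p v, dAt E f' p v) := by
  have h1 := (hf.mdifferentiableAt (by simp)).hasMFDerivAt
  have h2 := (hf'.mdifferentiableAt (by simp)).hasMFDerivAt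
  have h : HasMFDerivAt 𝓘(ℂ, E) 𝓘(ℂ, G × G') (fun q => (f q, f' q)) p
      ((dAt E f p).prod (dAt E f' p)) := ⟨h1.1.prodMk h2.1, h1.2.prodMk h2.2⟩
  exact congrArg (fun φ : TangentSpace 𝓘(ℂ, E) p →L[ℂ] G × G' => φ v) h.mfderiv

end Calculus

/-! ### Tangent transition functions and the symmetry of second derivatives -/

section Tangent

variable {E : Type*} [NormedAddCommGroup E] [NormedSpace ℂ E]
  {M : Type*} [TopologicalSpace M] [ChartedSpace E M] [IsManifold 𝓘(ℂ, E) ω M]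

/-- The transition functions of the tangent bundle are the derivatives of the coordinate changes. -/
theorem transition_tangent_eq {x y q : M} (hx : q ∈ (chartAt E x).source)
    (hy : q ∈ (chartAt E y).source) :
    transition E (fun p : M => TangentSpace 𝓘(ℂ, E) p) y x q =
      fderiv ℂ (chartAt E y ∘ (chartAt E x).symm) (chartAt E x q) := by
  ext v
  have : IsManifold 𝓘(ℂ, E) 1 M := .of_le (n := ω) le_top
  refine ((tangentBundleCore 𝓘(ℂ, E) M).trivializationAt_coordChange_eq (b₀ := x) (b₁ := y)
    ⟨hx, hy⟩ v).trans ?_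
  refine (congrArg (fun φ : E →L[ℂ] E => φ v)
    (tangentBundleCore_coordChange_achart (I := 𝓘(ℂ, E)) x y q)).trans ?_
  rw [modelWithCornersSelf_coe, range_id, fderivWithin_univ]
  rfl

/-- The transition function is the derivative of the coordinate change, so both sides are values of
its second derivative, which is symmetric. This is the torsion-freeness of the flat connections of
charts. -/
theorem dAt_transition_tangent_symm {x y p : M} (hx : p ∈ (chartAt E x).source)
    (hy : p ∈ (chartAt E y).source) (u v : TangentSpace 𝓘(ℂ, E) p) :
    dAt E (transition E (fun p : M => TangentSpace 𝓘(ℂ, E) p) y x) p u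
      ((trivializationAt E (fun p : M => TangentSpace 𝓘(ℂ, E) p) x).continuousLinearMapAt ℂ p v) =
    dAt E (transition E (fun p : M => TangentSpace 𝓘(ℂ, E) p) y x) p v
      ((trivializationAt E (fun p : M => TangentSpace 𝓘(ℂ, E) p) x).continuousLinearMapAt ℂ p u) := by
  have : IsManifold 𝓘(ℂ, E) 1 M := .of_le (n := ω) le_top
  have hs : ContDiffAt ℂ ω (chartAt E y ∘ (chartAt E x).symm) (chartAt E x p) := by
    have h := contDiffWithinAt_ext_coord_change (I := 𝓘(ℂ, E)) (n := ω) y x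
      (y := chartAt E x p) (by simp [mfld_simps, hx, hy])
    rw [modelWithCornersSelf_coe, range_id, contDiffWithinAt_univ] at h
    exact h
  have h1 : ∀ w : TangentSpace 𝓘(ℂ, E) p,
      dAt E (transition E (fun p : M => TangentSpace 𝓘(ℂ, E) p) y x) p w =
      fderiv ℂ (fderiv ℂ (chartAt E y ∘ (chartAt E x).symm)) (chartAt E x p)
        ((trivializationAt E (fun p : M => TangentSpace 𝓘(ℂ, E) p) x).continuousLinearMapAt ℂ p w) := by
    intro w
    have h2 : dAt E (transition E (fun p : M => TangentSpace 𝓘(ℂ, E) p) y x) p =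
        dAt E (fun q => fderiv ℂ (chartAt E y ∘ (chartAt E x).symm) (chartAt E x q)) p := by
      apply dAt_congr
      filter_upwards [(chartAt E x).open_source.mem_nhds hx,
        (chartAt E y).open_source.mem_nhds hy] with q hq hq'
      exact transition_tangent_eq hq hq'
    -- The differential of the chart at `x` is the coordinate map of the tangent trivialization, so
    -- the chain rule yields the second derivative in chart coordinates.
    rw [h2, dAt_comp]
    · congr 1
      exact congrArg (fun φ : TangentSpace 𝓘(ℂ, E) p →L[ℂ] E => φ w)
        (TangentBundle.continuousLinearMapAt_trivializationAt (I := 𝓘(ℂ, E)) hx).symm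
    · exact (hs.fderiv_right (m := ω) (by simp)).differentiableAt (by simp)
    · exact contMDiffAt_of_mem_maximalAtlas (IsManifold.chart_mem_maximalAtlas x) hx
  rw [h1, h1]
  exact hs.isSymmSndFDerivAt_of_omega _ _

end Tangent

/-! ### The cotangent bundle and the Hessian representative of `a(Ω¹)` -/

section Cotangent

instance (F : Type*) [NormedAddCommGroup F] [NormedSpace ℂ F] : FunLike (CovectorModel F) F ℂ :=
  inferInstanceAs (FunLike (F →L[ℂ] ℂ) F ℂ)

@[ext]
theorem CovectorModel.ext {F : Type*} [NormedAddCommGroup F] [NormedSpace ℂ F]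
    {l l' : CovectorModel F} (h : ∀ a, l a = l' a) : l = l' :=
  ContinuousLinearMap.ext h

/-- The transpose of an endomorphism, as a map of operator spaces. -/
def covectorTranspose (F : Type*) [NormedAddCommGroup F] [NormedSpace ℂ F] :
    (F →L[ℂ] F) →L[ℂ] (CovectorModel F →L[ℂ] CovectorModel F) :=
  (ContinuousLinearMap.compL ℂ F F ℂ).flip

theorem covectorTranspose_apply {F : Type*} [NormedAddCommGroup F] [NormedSpace ℂ F]
    (A : F →L[ℂ] F) (l : CovectorModel F) (a : F) : covectorTranspose F A l a = l (A a) := rfl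

variable {E : Type*} [NormedAddCommGroup E] [NormedSpace ℂ E]
  {M : Type*} [TopologicalSpace M] [ChartedSpace E M] [IsManifold 𝓘(ℂ, E) ω M]

/-- The trivialization of `Hom(T_M, ℂ)` precomposes with the inverse tangent trivialization, and
that of the trivial bundle is the identity. So the preferred coframe is dual to the coordinate
frame. -/
theorem cotangent_continuousLinearMapAt_apply {x p : M} (hx : p ∈ (chartAt E x).source)
    (l : Cotangent E p) (a : E) :
    (trivializationAt (CovectorModel E) (fun p : M => Cotangent E p) x).continuousLinearMapAt ℂ p l
      a =
      l ((trivializationAt E (fun p : M => TangentSpace 𝓘(ℂ, E) p) x).symmL ℂ p a) := by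
  have hp : p ∈ (trivializationAt (CovectorModel E) (fun p : M => Cotangent E p) x).baseSet :=
    ⟨hx, trivial⟩
  rw [Trivialization.continuousLinearMapAt_apply, Trivialization.coe_linearMapAt_of_mem _ hp]
  change ((trivializationAt ℂ (Bundle.Trivial M ℂ) x).continuousLinearMapAt ℂ p) _ = _
  rw [Trivialization.continuousLinearMapAt_apply,
    Trivialization.coe_linearMapAt_of_mem _ (by exact trivial)]
  rfl

theorem cotangent_symmL_apply {x p : M} (hx : p ∈ (chartAt E x).source)
    (l : CovectorModel E) (u : TangentSpace 𝓘(ℂ, E) p) :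
    ((trivializationAt (CovectorModel E) (fun p : M => Cotangent E p) x).symmL ℂ p l) u =
      l ((trivializationAt E (fun p : M => TangentSpace 𝓘(ℂ, E) p) x).continuousLinearMapAt ℂ p u) := by
  have hp : p ∈ (trivializationAt (CovectorModel E) (fun p : M => Cotangent E p) x).baseSet :=
    ⟨hx, trivial⟩
  have h := cotangent_continuousLinearMapAt_apply hx
    ((trivializationAt (CovectorModel E) (fun p : M => Cotangent E p) x).symmL ℂ p l)
    ((trivializationAt E (fun p : M => TangentSpace 𝓘(ℂ, E) p) x).continuousLinearMapAt ℂ p u)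
  rw [Trivialization.continuousLinearMapAt_symmL _ hp,
    Trivialization.symmL_continuousLinearMapAt _ hx] at h
  exact h.symm

/-- The transition functions of the cotangent bundle are the transposes of the inverses of those
of the tangent bundle. -/
theorem transition_cotangent {x y p : M} (hx : p ∈ (chartAt E x).source)
    (hy : p ∈ (chartAt E y).source) :
    transition (CovectorModel E) (fun p : M => Cotangent E p) x y p =
      covectorTranspose E (transition E (fun p : M => TangentSpace 𝓘(ℂ, E) p) y x p) := by
  have hx' : p ∈ (trivializationAt (CovectorModel E) (fun p : M => Cotangent E p) x).baseSet :=
    ⟨hx, trivial⟩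
  have hy' : p ∈ (trivializationAt (CovectorModel E) (fun p : M => Cotangent E p) y).baseSet :=
    ⟨hy, trivial⟩
  refine ContinuousLinearMap.ext fun l => CovectorModel.ext fun a => ?_
  rw [transition_apply _ _ hx' hy', covectorTranspose_apply,
    cotangent_continuousLinearMapAt_apply hx, cotangent_symmL_apply hy, transition_apply E _ hy hx]

theorem dAt_transition_cotangent {x y p : M} (hx : p ∈ (chartAt E x).source)
    (hy : p ∈ (chartAt E y).source) (v : TangentSpace 𝓘(ℂ, E) p) :
    dAt E (transition (CovectorModel E) (fun p : M => Cotangent E p) x y) p v =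
      covectorTranspose E (dAt E (transition E (fun p : M => TangentSpace 𝓘(ℂ, E) p) y x) p v) := by
  have h : dAt E (transition (CovectorModel E) (fun p : M => Cotangent E p) x y) p =
      dAt E (fun q => covectorTranspose E (transition E (fun p : M => TangentSpace 𝓘(ℂ, E) p) y x q)) p := by
    apply dAt_congr
    filter_upwards [(chartAt E x).open_source.mem_nhds hx,
      (chartAt E y).open_source.mem_nhds hy] with q hq hq'
    exact transition_cotangent hq hq'
  rw [h, dAt_comp (covectorTranspose E).differentiableAt, (covectorTranspose E).fderiv]
  exact (contMDiffOn_transition E E _ y x).contMDiffAt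
    (((chartAt E y).open_source.inter (chartAt E x).open_source).mem_nhds ⟨hy, hx⟩)

variable [FiniteDimensional ℂ E]

/-- The cotangent transition function from `y` to `x` is the transpose of the tangent one from `x`
to `y`. Transposition is linear, so it commutes with `d`; the indices are exchanged and no sign
appears. -/
theorem atiyahForm_cotangent {x y p : M} (hx : p ∈ (chartAt E x).source)
    (hy : p ∈ (chartAt E y).source) :
    atiyahForm E (CovectorModel E) (fun p : M => Cotangent E p) x y p =
      bilinMap _ (atiyahForm E E (fun p : M => TangentSpace 𝓘(ℂ, E) p) y x p) := by
  refine ContinuousLinearMap.ext fun v => ContinuousLinearMap.ext fun l =>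
    ContinuousLinearMap.ext fun u => ?_
  refine Eq.trans ?_ (bilinMap_apply _ v u l).symm
  rw [atiyahForm_apply, atiyahForm_apply, dAt_transition_cotangent hx hy, map_smul]
  refine congrArg (fun c : ℂ => (2 * Real.pi * Complex.I : ℂ)⁻¹ • c) ?_
  refine (cotangent_symmL_apply hx _ u).trans ?_
  rw [covectorTranspose_apply, cotangent_continuousLinearMapAt_apply hy]

-- Up to the factor `1 / 2πi` and the frame at `y`, this form is the Hessian of the coordinate
-- change.
omit [FiniteDimensional ℂ E] in
theorem atiyahForm_tangent_mem_symForms {x y p : M} (hx : p ∈ (chartAt E x).source)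
    (hy : p ∈ (chartAt E y).source) :
    atiyahForm E E (fun p : M => TangentSpace 𝓘(ℂ, E) p) y x p ∈
      symForms (TangentSpace 𝓘(ℂ, E) p) := by
  intro u v
  rw [atiyahForm_apply, atiyahForm_apply, dAt_transition_tangent_symm hx hy]

variable (E M) in
/-- The cocycle of the symmetric tensors `(1 / 2πi) ∑ ∂²y_k / ∂x_i ∂x_j dx_i dx_j ⊗ ∂ / ∂y_k`. -/
def hessianCocycle : (symSheaf E M).Z1 (trivCover (CovectorModel E) (fun p : M => Cotangent E p)) :=
  ⟨fun x y => ⟨fun p => atiyahForm E E (fun p : M => TangentSpace 𝓘(ℂ, E) p) y x p,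
      ⟨atiyahForm E E (fun p : M => TangentSpace 𝓘(ℂ, E) p) y x,
        (holOn_atiyahForm E E _ y x).mono fun _ hp => ⟨hp.2.1, hp.1.1⟩, fun _ => rfl⟩,
      fun p _ => atiyahForm_tangent_mem_symForms p.2.1.1 p.2.2.1⟩, by
    change (symSheaf E M).d1 _ _ = 0
    funext x y z
    refine Subtype.ext (funext fun p => ?_)
    -- The tangent cocycle identity is taken in the reversed order `z, y, x`, because dualizing
    -- exchanged the two indices.
    have h := atiyahForm_cocycle E E (fun p : M => TangentSpace 𝓘(ℂ, E) p) (x := z) (y := y)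
      (z := x) (p := p) p.2.2.1 p.2.1.2.1 p.2.1.1.1
    refine Eq.trans ?_ h
    change atiyahForm E E (fun p : M => TangentSpace 𝓘(ℂ, E) p) z y p -
      atiyahForm E E (fun p : M => TangentSpace 𝓘(ℂ, E) p) z x p +
      atiyahForm E E (fun p : M => TangentSpace 𝓘(ℂ, E) p) y x p = _
    abel⟩

/-- The two cocycles live on the same cover and agree entry by entry, by `atiyahForm_cotangent`.
This supplies the preimage of `a(Ω¹)` in the symmetric part. -/
theorem symInclusionH1_hessianCocycle :
    symInclusionH1 E M ((symSheaf E M).cls (hessianCocycle E M)) = atiyahClassCotangent E M := by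
  refine (SectionPresheaf.mapH1_cls (symInclusion E M) (hessianCocycle E M)).trans ?_
  refine congrArg _ (Subtype.ext (funext fun x => funext fun y => Subtype.ext (funext fun p => ?_)))
  exact (atiyahForm_cotangent p.2.1.1 p.2.2.1).symm

end Cotangent

/-! ### Linear algebra in one fibre: symmetrization, trace, symmetric product -/

section FibrewiseMaps

variable {T : Type*} [AddCommGroup T] [Module ℂ T] [TopologicalSpace T] [IsTopologicalAddGroup T]
  [ContinuousSMul ℂ T] [T2Space T] [FiniteDimensional ℂ T]
  {X : Type*} [AddCommGroup X] [Module ℂ X] [TopologicalSpace X] [IsTopologicalAddGroup X]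
  [ContinuousSMul ℂ X]

/-- A bilinear map on a finite-dimensional space, as a continuous bilinear map. -/
def clmMk₂ (f : T → T → X) (h₁ : ∀ u u' v, f (u + u') v = f u v + f u' v)
    (h₂ : ∀ (c : ℂ) u v, f (c • u) v = c • f u v)
    (h₃ : ∀ u v v', f u (v + v') = f u v + f u v')
    (h₄ : ∀ (c : ℂ) u v, f u (c • v) = c • f u v) : T →L[ℂ] T →L[ℂ] X :=
  LinearMap.toContinuousLinearMap
    ((LinearMap.toContinuousLinearMap (𝕜 := ℂ) (E := T) (F' := X)).toLinearMap ∘ₗ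
      LinearMap.mk₂ ℂ f h₁ h₂ h₃ h₄)

theorem clmMk₂_apply (f : T → T → X) (h₁ : ∀ u u' v, f (u + u') v = f u v + f u' v)
    (h₂ : ∀ (c : ℂ) u v, f (c • u) v = c • f u v)
    (h₃ : ∀ u v v', f u (v + v') = f u v + f u v')
    (h₄ : ∀ (c : ℂ) u v, f u (c • v) = c • f u v) (u v : T) :
    clmMk₂ f h₁ h₂ h₃ h₄ u v = f u v := rfl

omit [IsTopologicalAddGroup T] [ContinuousSMul ℂ T] [T2Space T] [FiniteDimensional ℂ T] in
theorem Covector.add_apply (l l' : Covector T) (v : T) : (l + l') v = l v + l' v := rfl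

omit [IsTopologicalAddGroup T] [ContinuousSMul ℂ T] [T2Space T] [FiniteDimensional ℂ T] in
theorem Covector.smul_apply (c : ℂ) (l : Covector T) (v : T) : (c • l) v = c * l v := rfl

/-- The coordinate functionals of a basis suffice. Identities between vectors known only through
their pairings, such as `contractVector`, are proved this way. -/
theorem Covector.separates {s t : T} (h : ∀ l : Covector T, l s = l t) : s = t := by
  refine (Module.finBasis ℂ T).ext_elem fun i => ?_
  exact h (LinearMap.toContinuousLinearMap ((Module.finBasis ℂ T).coord i) : T →L[ℂ] ℂ)

/-- The vector with given values on covectors. -/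
theorem exists_vector_of_covector_values (φ : Covector T →ₗ[ℂ] ℂ) :
    ∃ t : T, ∀ l : Covector T, l t = φ l := by
  let b := Module.finBasis ℂ T
  let c : Fin (Module.finrank ℂ T) → Covector T := fun i =>
    (LinearMap.toContinuousLinearMap (b.coord i) : T →L[ℂ] ℂ)
  refine ⟨∑ i, φ (c i) • b i, fun l => ?_⟩
  -- Expansion of `l` in the dual basis `c`; the witness above has the matching coefficients `φ (c
  -- i)`.
  have hl : l = ∑ i, l (b i) • c i := by
    apply ContinuousLinearMap.coe_injective
    refine b.ext fun j => ?_
    have h : l (b j) = ∑ i, l (b i) * b.coord i (b j) := by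
      simp [Finsupp.single_apply]
    refine h.trans ?_
    -- Evaluation at `b j`, packaged as an additive map so that it passes through the sum.
    let ev : Covector T →+ ℂ := ⟨⟨fun l => l (b j), rfl⟩, fun _ _ => rfl⟩
    change _ = ev (∑ i, l (b i) • c i)
    rw [map_sum]
    rfl
  rw [map_sum]
  conv_rhs => rw [hl, map_sum]
  refine Finset.sum_congr rfl fun i _ => ?_
  rw [map_smul, map_smul, smul_eq_mul, smul_eq_mul, mul_comm]

/-- The vector `t` with `l t = Φ u l v` for all covectors `l`. -/
def contractVector (Φ : T →L[ℂ] Covector T →L[ℂ] Covector T) (u v : T) : T :=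
  (exists_vector_of_covector_values (T := T)
    { toFun := fun l => Φ u l v
      map_add' := fun l l' => by rw [map_add]; rfl
      map_smul' := fun c l => by rw [map_smul]; rfl }).choose

theorem covector_contractVector (Φ : T →L[ℂ] Covector T →L[ℂ] Covector T) (u v : T)
    (l : Covector T) : l (contractVector Φ u v) = Φ u l v :=
  (exists_vector_of_covector_values (T := T)
    { toFun := fun l => Φ u l v
      map_add' := fun l l' => by rw [map_add]; rfl
      map_smul' := fun c l => by rw [map_smul]; rfl }).choose_spec l

variable (T) in
/-- The symmetrization `T* ⊗ End T* = T* ⊗ T* ⊗ T → S²T* ⊗ T`. -/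
def symmetrizeMap : (T →L[ℂ] Covector T →L[ℂ] Covector T) →ₗ[ℂ] (T →L[ℂ] T →L[ℂ] T) where
  -- The factor `1 / 2` makes this a left inverse of `bilinMap` on symmetric tensors. Linearity is
  -- verified after pairing with covectors, where `contractVector` becomes `Φ u l v`.
  toFun Φ := clmMk₂ (fun u v => (1 / 2 : ℂ) • (contractVector Φ u v + contractVector Φ v u))
    (fun u u' v => Covector.separates fun l => by
      simp only [map_smul, map_add, covector_contractVector, smul_eq_mul, add_apply, Covector.add_apply]
      ring)
    (fun c u v => Covector.separates fun l => by
      simp only [map_smul, map_add, covector_contractVector, smul_eq_mul, smul_apply, Covector.smul_apply]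
      ring)
    (fun u v v' => Covector.separates fun l => by
      simp only [map_smul, map_add, covector_contractVector, smul_eq_mul, add_apply, Covector.add_apply]
      ring)
    (fun c u v => Covector.separates fun l => by
      simp only [map_smul, map_add, covector_contractVector, smul_eq_mul, smul_apply, Covector.smul_apply]
      ring)
  map_add' Φ Ψ := ContinuousLinearMap.ext fun u => ContinuousLinearMap.ext fun v =>
    Covector.separates fun l => by
      simp only [add_apply, clmMk₂_apply, map_smul, map_add, covector_contractVector, smul_eq_mul, Covector.add_apply]
      ring
  map_smul' c Φ := ContinuousLinearMap.ext fun u => ContinuousLinearMap.ext fun v =>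
    Covector.separates fun l => by
      simp only [smul_apply, clmMk₂_apply, map_smul, map_add, covector_contractVector, smul_eq_mul, Covector.smul_apply,
        RingHom.id_apply]
      ring

theorem symmetrizeMap_apply (Φ : T →L[ℂ] Covector T →L[ℂ] Covector T) (u v : T) :
    symmetrizeMap T Φ u v = (1 / 2 : ℂ) • (contractVector Φ u v + contractVector Φ v u) := rfl

theorem symmetrizeMap_bilinMap {B : T →L[ℂ] T →L[ℂ] T} (hB : B ∈ symForms T) :
    symmetrizeMap T (bilinMap T B) = B := by
  refine ContinuousLinearMap.ext fun u => ContinuousLinearMap.ext fun v =>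
    Covector.separates fun l => ?_
  rw [symmetrizeMap_apply, map_smul, map_add, covector_contractVector, covector_contractVector,
    bilinMap_apply, bilinMap_apply, hB v u, smul_eq_mul]
  ring

variable (T) in
/-- The trace `S²T* ⊗ T → T*`, `B ↦ (v ↦ tr B(v, ·))`. -/
def traceMap : (T →L[ℂ] T →L[ℂ] T) →ₗ[ℂ] (T →L[ℂ] ℂ) where
  toFun B := LinearMap.toContinuousLinearMap
    (LinearMap.trace ℂ T ∘ₗ ContinuousLinearMap.coeLM ℂ ∘ₗ B.toLinearMap)
  map_add' B C := ContinuousLinearMap.ext fun v =>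
    map_add (LinearMap.trace ℂ T) (B v).toLinearMap (C v).toLinearMap
  map_smul' c B := ContinuousLinearMap.ext fun v =>
    map_smul (LinearMap.trace ℂ T) c (B v).toLinearMap

theorem traceMap_apply (B : T →L[ℂ] T →L[ℂ] T) (v : T) :
    traceMap T B v = LinearMap.trace ℂ T (B v).toLinearMap := rfl

variable (T) in
/-- The map `T* → S²T* ⊗ T`, `ξ ↦ id ⊗ ξ + ξ ⊗ id`. -/
def symProdMap : (T →L[ℂ] ℂ) →ₗ[ℂ] (T →L[ℂ] T →L[ℂ] T) where
  toFun ξ := clmMk₂ (fun u v => ξ u • v + ξ v • u)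
    (fun u u' v => by rw [map_add, add_smul, smul_add]; abel)
    (fun c u v => by rw [map_smul, smul_add, smul_assoc, smul_comm (ξ v)])
    (fun u v v' => by rw [map_add, add_smul, smul_add]; abel)
    (fun c u v => by rw [map_smul, smul_add, smul_assoc, smul_comm (ξ u)])
  map_add' ξ η := ContinuousLinearMap.ext fun u => ContinuousLinearMap.ext fun v => by
    simp only [add_apply, clmMk₂_apply, add_smul]
    abel
  map_smul' c ξ := ContinuousLinearMap.ext fun u => ContinuousLinearMap.ext fun v => by
    simp only [smul_apply, clmMk₂_apply, smul_add, smul_assoc, RingHom.id_apply]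

theorem symProdMap_apply (ξ : T →L[ℂ] ℂ) (u v : T) : symProdMap T ξ u v = ξ u • v + ξ v • u := rfl

theorem bilinMap_symProdMap (ξ : T →L[ℂ] ℂ) :
    bilinMap T (symProdMap T ξ) = idTensorMap T ξ + tensorIdMap T ξ := by
  refine ContinuousLinearMap.ext fun v => ContinuousLinearMap.ext fun l =>
    ContinuousLinearMap.ext fun u => ?_
  refine (map_add l _ _).trans ?_
  refine congrArg₂ (· + ·) (map_smul l _ _) ?_
  exact (map_smul l _ _).trans (tensorIdMap_apply ξ v u l).symm

/-- The endomorphism attached to `v` is `ξ(v) · id`, of trace `n ξ(v)`, plus the rank-one map `u ↦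
ξ(u) v`, of trace `ξ(v)`. -/
theorem traceMap_symProdMap (ξ : T →L[ℂ] ℂ) :
    traceMap T (symProdMap T ξ) = ((Module.finrank ℂ T : ℂ) + 1) • ξ := by
  refine ContinuousLinearMap.ext fun v => ?_
  have h : (symProdMap T ξ v).toLinearMap = ξ v • LinearMap.id + ξ.toLinearMap.smulRight v := rfl
  rw [traceMap_apply, h, map_add, map_smul, LinearMap.trace_id, LinearMap.trace_smulRight]
  simp
  ring

/-- The endomorphism attached to `u` factors as `T → L → T`. Its trace equals that of the opposite
composite on the line `L`, which is multiplication by `ξ(u)`. -/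
theorem traceMap_tensorMap_sharpMap {L : Type*} [AddCommGroup L] [Module ℂ L] [TopologicalSpace L]
    [IsTopologicalAddGroup L] [ContinuousSMul ℂ L] (hL : Module.finrank ℂ L = 1)
    {B : T →L[ℂ] T →L[ℂ] L} (hB : ∀ u v, B u v = B v u) (ξ : T →L[ℂ] ℂ)
    (h : ∀ l v, B (sharpMap B ξ l) v = ξ v • l) :
    traceMap T (tensorMap B (sharpMap B ξ)) = ξ := by
  have : Module.Finite ℂ L := Module.finite_of_finrank_eq_succ hL
  refine ContinuousLinearMap.ext fun u => ?_
  have h1 : (tensorMap B (sharpMap B ξ) u).toLinearMap =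
      (sharpMap B ξ).toLinearMap ∘ₗ (B u).toLinearMap := rfl
  -- Symmetry of `B` moves the vector `sharpMap B ξ l` into the first slot, where its defining
  -- property `h` applies.
  have h2 : (B u).toLinearMap ∘ₗ (sharpMap B ξ).toLinearMap = ξ u • LinearMap.id :=
    LinearMap.ext fun l => (hB _ _).trans (h l u)
  rw [traceMap_apply, h1, LinearMap.trace_comp_comm', h2, map_smul, LinearMap.trace_id, hL]
  simp

end FibrewiseMaps

/-! ### The fibrewise maps as morphisms of sheaves -/

section SheafMaps

variable {E : Type*} [NormedAddCommGroup E] [NormedSpace ℂ E] [FiniteDimensional ℂ E]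
  {M : Type*} [TopologicalSpace M] [ChartedSpace E M] [IsManifold 𝓘(ℂ, E) ω M]

/-- A vector field is holomorphic if its pairings with local holomorphic 1-forms are. -/
theorem holOn_tangent_of_covector {U : Set M} (hU : IsOpen U)
    {u : Π p : M, TangentSpace 𝓘(ℂ, E) p}
    (h : ∀ W ⊆ U, IsOpen W → ∀ l : Π p : M, Cotangent E p, HolOn E (CovectorModel E) W l →
      ContMDiffOn 𝓘(ℂ, E) 𝓘(ℂ, ℂ) ω (fun p => l p (u p)) W) : HolOn E E U u := by
  intro x hx
  apply ContMDiffAt.contMDiffWithinAt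
  let e := trivializationAt E (fun p : M => TangentSpace 𝓘(ℂ, E) p) x
  have hxe : x ∈ e.baseSet := mem_baseSet_trivializationAt E _ x
  have hO : IsOpen (U ∩ e.baseSet) := hU.inter e.open_baseSet
  rw [contMDiffAt_section]
  let b := Module.finBasis ℂ E
  have h1 : ∀ i, ContMDiffAt 𝓘(ℂ, E) 𝓘(ℂ, ℂ) ω
      (fun p => b.coord i (e.continuousLinearMapAt ℂ p (u p))) x := by
    intro i
    -- The test form has constant coefficient `c` in the coframe at `x`; pairing with it reads off
    -- the `i`-th component of `u`.
    let c : CovectorModel E := (LinearMap.toContinuousLinearMap (b.coord i) : E →L[ℂ] ℂ)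
    have h2 := HolOn.symmL E (CovectorModel E) (fun p : M => Cotangent E p) x
      (U := U ∩ e.baseSet) (by exact fun p hp => ⟨hp.2, trivial⟩) (f := fun _ => c) contMDiffOn_const
    have h3 := (h _ inter_subset_left hO _ h2).contMDiffAt (hO.mem_nhds ⟨hx, hxe⟩)
    refine h3.congr_of_eventuallyEq ?_
    filter_upwards [e.open_baseSet.mem_nhds hxe] with p hp
    exact (cotangent_symmL_apply hp c (u p)).symm
  have h2 : ContMDiffAt 𝓘(ℂ, E) 𝓘(ℂ, E) ω
      (fun p => ∑ i, b.coord i (e.continuousLinearMapAt ℂ p (u p)) • b i) x :=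
    contMDiffAt_finsetSum fun i _ => (h1 i).smul contMDiffAt_const
  refine h2.congr_of_eventuallyEq ?_
  filter_upwards [e.open_baseSet.mem_nhds hxe] with p hp
  refine Eq.trans ?_ (b.sum_repr (e.continuousLinearMapAt ℂ p (u p))).symm
  rw [e.continuousLinearMapAt_apply ℂ, e.coe_linearMapAt_of_mem hp]

/-- In local coordinates `Φ` is conjugated by the trivialization, which leaves the trace unchanged.
So near a point the trace is a fixed linear functional of the holomorphic coordinate expression. -/
theorem contMDiffOn_trace {U : Set M} (hU : IsOpen U)
    {Φ : Π p : M, TangentSpace 𝓘(ℂ, E) p →L[ℂ] TangentSpace 𝓘(ℂ, E) p}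
    (h : HolOn E (E →L[ℂ] E) U Φ) :
    ContMDiffOn 𝓘(ℂ, E) 𝓘(ℂ, ℂ) ω
      (fun p => LinearMap.trace ℂ (TangentSpace 𝓘(ℂ, E) p) (Φ p).toLinearMap) U := by
  intro x hx
  apply ContMDiffAt.contMDiffWithinAt
  have h0 : ContMDiffAt _ _ _ _ x := h.contMDiffAt (hU.mem_nhds hx)
  rw [contMDiffAt_hom_bundle] at h0
  let τ : (E →L[ℂ] E) →L[ℂ] ℂ := LinearMap.toContinuousLinearMap
    (LinearMap.trace ℂ E ∘ₗ ContinuousLinearMap.coeLM ℂ)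
  have h1 := τ.contMDiff.contMDiffAt.comp x h0.2
  refine h1.congr_of_eventuallyEq ?_
  let e := trivializationAt E (fun p : M => TangentSpace 𝓘(ℂ, E) p) x
  have hxe : x ∈ e.baseSet := mem_baseSet_trivializationAt E _ x
  filter_upwards [e.open_baseSet.mem_nhds hxe] with p hp
  simp only [Function.comp_apply]
  rw [ContinuousLinearMap.inCoordinates_eq hp hp]
  exact (LinearMap.trace_conj' (Φ p).toLinearMap
    (e.continuousLinearEquivAt ℂ p hp).toLinearEquiv).symm

variable (E M)

/-- The symmetrization `Ω¹ ⊗ End Ω¹ → S²Ω¹ ⊗ T_M`. -/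
def symmetrization : (endCotangentSheaf E M).Hom (symSheaf E M) where
  toFun p := symmetrizeMap (TangentSpace 𝓘(ℂ, E) p)
  map_mem U s := by
    rintro ⟨t, ht, hts⟩
    refine ⟨⟨fun p => symmetrizeMap _ (t p), ?_, fun p => congrArg _ (hts p)⟩, fun p _ u v => ?_⟩
    -- The vectors `contractVector` are obtained by choice, so holomorphy is tested on their
    -- pairings with 1-forms, which are explicit in `t`.
    · refine holOn_hom U.2 fun W hW hWo u hu => holOn_hom hWo fun W' hW' hWo' v hv =>
        holOn_tangent_of_covector hWo' fun W'' hW'' hWo'' l hl => ?_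
      have ht' := HolOn.mono ht ((hW''.trans hW').trans hW)
      have hu' := HolOn.mono hu (hW''.trans hW')
      have hv' := HolOn.mono hv hW''
      have h1 := holOn_covector_apply (HolOn.apply (HolOn.apply ht' hu') hl) hv'
      have h2 := holOn_covector_apply (HolOn.apply (HolOn.apply ht' hv') hl) hu'
      have h3 : ContMDiffOn 𝓘(ℂ, E) 𝓘(ℂ, ℂ) ω (fun _ : M => (1 / 2 : ℂ)) W'' := contMDiffOn_const
      refine (h3.smul (h1.add h2)).congr fun p _ => ?_
      rw [symmetrizeMap_apply, map_smul, map_add, covector_contractVector, covector_contractVector]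
      rfl
    · refine (symmetrizeMap_apply (s p) u v).trans (Eq.trans ?_ (symmetrizeMap_apply (s p) v u).symm)
      rw [add_comm]

/-- Symmetrization is a left inverse of the inclusion already on sheaves, hence on `H¹` by
functoriality. -/
theorem symInclusionH1_injective : Function.Injective (symInclusionH1 E M) := by
  refine Function.LeftInverse.injective (g := (symmetrization E M).mapH1) fun c => ?_
  have h := SectionPresheaf.mapH1_eq_comp (φ := symInclusion E M) (ψ := symmetrization E M)
    -- Multiplication by `1` plays the role of the identity morphism.
    (χ := SectionPresheaf.Hom.scalar _ 1) (fun U s hs p => ?_) c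
  · exact h.trans ((SectionPresheaf.Hom.scalar_mapH1 1 c).trans (one_smul _ _))
  · exact (symmetrizeMap_bilinMap (hs.2 p trivial)).trans (one_smul ℂ (s p)).symm

/-- The trace `S²Ω¹ ⊗ T_M → Ω¹`. -/
def symTrace : (symSheaf E M).Hom (formSheaf E M) where
  toFun p := traceMap (TangentSpace 𝓘(ℂ, E) p)
  map_mem U s := by
    rintro ⟨⟨t, ht, hts⟩, -⟩
    refine ⟨fun p => traceMap _ (t p), ?_, fun p => congrArg _ (hts p)⟩
    refine holOn_hom U.2 fun W hW hWo v hv => holOn_const_iff.2 ?_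
    exact contMDiffOn_trace hWo (HolOn.apply (HolOn.mono ht hW) hv)

/-- The morphism `Ω¹ → S²Ω¹ ⊗ T_M`, `ξ ↦ id ⊗ ξ + ξ ⊗ id`. -/
def symProd : (formSheaf E M).Hom (symSheaf E M) where
  toFun p := symProdMap (TangentSpace 𝓘(ℂ, E) p)
  map_mem U s := by
    rintro ⟨t, ht, hts⟩
    refine ⟨⟨fun p => symProdMap _ (t p), ?_, fun p => congrArg _ (hts p)⟩,
      fun p _ u v => add_comm _ _⟩
    refine holOn_hom U.2 fun W hW hWo u hu => holOn_hom hWo fun W' hW' hWo' v hv => ?_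
    have ht' := HolOn.mono ht (hW'.trans hW)
    have h1 := holOn_const_iff.1 (HolOn.apply ht' (HolOn.mono hu hW'))
    have h2 := holOn_const_iff.1 (HolOn.apply ht' hv)
    exact ContMDiffOn.add_section (ContMDiffOn.smul_section h1 hv)
      (ContMDiffOn.smul_section h2 (HolOn.mono hu hW'))

/-- On cocycles this is the fibrewise identity `bilinMap_symProdMap`. It places the class `id ⊗ c +
c ⊗ id` in the symmetric part, with an explicit preimage. -/
theorem symInclusionH1_symProd (c : H1Form E M) :
    symInclusionH1 E M ((symProd E M).mapH1 c) = idTensorH1 E M c + tensorIdH1 E M c := by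
  obtain ⟨𝒰, f, rfl⟩ := SectionPresheaf.exists_cls_eq c
  have h1 := SectionPresheaf.mapH1_cls (symProd E M) f
  have h2 := SectionPresheaf.mapH1_cls (symInclusion E M) ((symProd E M).mapZ1 𝒰 f)
  have h3 := SectionPresheaf.mapH1_cls (idTensor E M) f
  have h4 := SectionPresheaf.mapH1_cls (tensorId E M) f
  refine (congrArg (symInclusionH1 E M) h1).trans (h2.trans (Eq.trans ?_
    (congrArg₂ (· + ·) h3 h4).symm))
  refine Eq.trans (congrArg (endCotangentSheaf E M).cls ?_) (SectionPresheaf.cls_add _ _)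
  refine Subtype.ext (funext fun x => funext fun y => Subtype.ext (funext fun p => ?_))
  exact bilinMap_symProdMap ((f.1 x y).1 p)

end SheafMaps

/-! ### The canonical class as the trace of `a(Ω¹)` -/

theorem det_covectorTranspose {F : Type*} [NormedAddCommGroup F] [NormedSpace ℂ F]
    [FiniteDimensional ℂ F] (A : F →L[ℂ] F) : (covectorTranspose F A).det = A.det := by
  let e : Module.Dual ℂ F ≃ₗ[ℂ] CovectorModel F :=
    (LinearMap.toContinuousLinearMap (𝕜 := ℂ) (E := F) (F' := ℂ))
  have h : (covectorTranspose F A).toLinearMap =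
      e.toLinearMap ∘ₗ (Module.Dual.transpose (R := ℂ) A.toLinearMap) ∘ₗ e.symm.toLinearMap := rfl
  change LinearMap.det (covectorTranspose F A).toLinearMap = LinearMap.det A.toLinearMap
  rw [h, LinearMap.det_conj]
  exact LinearMap.det_dualMap A.toLinearMap

section CanonicalClass

variable {E : Type*} [NormedAddCommGroup E] [NormedSpace ℂ E] [FiniteDimensional ℂ E]
  {M : Type*} [TopologicalSpace M] [ChartedSpace E M] [IsManifold 𝓘(ℂ, E) ω M]

theorem transition_canonicalBundle {x y p : M} (hx : p ∈ (chartAt E x).source)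
    (hy : p ∈ (chartAt E y).source) :
    transition ℂ (canonicalBundle E M).Fiber x y p 1 =
      (transition E (fun p : M => TangentSpace 𝓘(ℂ, E) p) y x p).det := by
  refine ((canonicalBundle E M).trivializationAt_coordChange_eq (b₀ := y) (b₁ := x)
    ⟨⟨hy, trivial⟩, ⟨hx, trivial⟩⟩ 1).trans ?_
  rw [← det_covectorTranspose, ← transition_cotangent hx hy]
  exact mul_one _

/-- By Jacobi's formula `dlog det h = tr(h⁻¹ dh)`. The right-hand side is the same trace, since the
frames in `atiyahForm` combine to `h⁻¹` after a cyclic permutation. -/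
theorem dlogForm_canonicalBundle {x y p : M} (hx : p ∈ (chartAt E x).source)
    (hy : p ∈ (chartAt E y).source) :
    dlogForm E (canonicalBundle E M).Fiber x y p =
      traceMap _ (atiyahForm E E (fun p : M => TangentSpace 𝓘(ℂ, E) p) y x p) := by
  let h := transition E (fun p : M => TangentSpace 𝓘(ℂ, E) p)
  refine ContinuousLinearMap.ext fun v => ?_
  have h1 : dAt E (fun q => transition ℂ (canonicalBundle E M).Fiber x y q 1) p =
      dAt E (fun q => (h y x q).det) p := by
    apply dAt_congr
    filter_upwards [(chartAt E x).open_source.mem_nhds hx,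
      (chartAt E y).open_source.mem_nhds hy] with q hq hq'
    exact transition_canonicalBundle hq hq'
  -- The inverse required by Jacobi's formula is the opposite transition function.
  have hm : h y x p * h x y p = 1 := by
    rw [transition_mul E _ hy hx hy, transition_self E _ hy]
  have h2 : dAt E (fun q => (h y x q).det) p v =
      (h y x p).det * LinearMap.trace ℂ E (h x y p * dAt E (h y x) p v : E →L[ℂ] E) := by
    rw [dAt_comp (F := fun A : E →L[ℂ] E => A.det)
      ((contDiff_clm_det E).differentiable (by simp) _), fderiv_clm_det hm]
    exact (contMDiffOn_transition E E _ y x).contMDiffAt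
      (((chartAt E y).open_source.inter (chartAt E x).open_source).mem_nhds ⟨hy, hx⟩)
  have h3 : (h y x p).det ≠ 0 := by
    rw [← transition_canonicalBundle hx hy]
    exact transition_one_ne_zero _ x y p
  let e := trivializationAt E (fun p : M => TangentSpace 𝓘(ℂ, E) p)
  have h4 : (atiyahForm E E (fun p : M => TangentSpace 𝓘(ℂ, E) p) y x p v).toLinearMap =
      (2 * Real.pi * Complex.I : ℂ)⁻¹ • (((e y).symmL ℂ p).toLinearMap ∘ₗ
        ((dAt E (h y x) p v : E →L[ℂ] E) ∘L (e x).continuousLinearMapAt ℂ p).toLinearMap) := rfl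
  -- The composite left by the first cyclic permutation: the frame at `y` followed by the
  -- coordinates at `x` is `h x y`.
  have h5 : ((dAt E (h y x) p v : E →L[ℂ] E) ∘L (e x).continuousLinearMapAt ℂ p).toLinearMap ∘ₗ
      ((e y).symmL ℂ p).toLinearMap =
      (dAt E (h y x) p v : E →L[ℂ] E).toLinearMap ∘ₗ (h x y p).toLinearMap :=
    LinearMap.ext fun a => congrArg (dAt E (h y x) p v : E →L[ℂ] E)
      (transition_apply E _ hx hy a).symm
  have h6 : traceMap _ (atiyahForm E E (fun p : M => TangentSpace 𝓘(ℂ, E) p) y x p) v =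
      (2 * Real.pi * Complex.I : ℂ)⁻¹ *
        LinearMap.trace ℂ E (h x y p * dAt E (h y x) p v : E →L[ℂ] E) := by
    rw [traceMap_apply, h4, map_smul, LinearMap.trace_comp_comm', h5, LinearMap.trace_comp_comm']
    rfl
  rw [h6]
  change (2 * Real.pi * Complex.I : ℂ)⁻¹ * ((transition ℂ (canonicalBundle E M).Fiber x y p 1)⁻¹ *
    dAt E (fun q => transition ℂ (canonicalBundle E M).Fiber x y q 1) p v) = _
  rw [h1, h2, transition_canonicalBundle hx hy]
  change _ * ((h y x p).det⁻¹ * _) = _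
  rw [inv_mul_cancel_left₀ h3]

theorem symTrace_hessianCocycle :
    (symTrace E M).mapH1 ((symSheaf E M).cls (hessianCocycle E M)) = canonicalClass E M := by
  refine (SectionPresheaf.mapH1_cls (symTrace E M) (hessianCocycle E M)).trans ?_
  -- The covers coincide, since `detBundle` is built on the trivialization domains of the cotangent
  -- bundle.
  refine SectionPresheaf.cls_congr (fun x => rfl) fun x y p hp hp' => ?_
  exact (dlogForm_canonicalBundle hp.1.1 hp.2.1).symm

end CanonicalClass

/-! ### The product rule and Koszul's formula -/

theorem dAt_clm_apply {E : Type*} [NormedAddCommGroup E] [NormedSpace ℂ E]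
    {M : Type*} [TopologicalSpace M] [ChartedSpace E M]
    {G : Type*} [NormedAddCommGroup G] [NormedSpace ℂ G]
    {G' : Type*} [NormedAddCommGroup G'] [NormedSpace ℂ G']
    {c : M → G →L[ℂ] G'} {f : M → G} {p : M}
    (hc : ContMDiffAt 𝓘(ℂ, E) 𝓘(ℂ, G →L[ℂ] G') ω c p)
    (hf : ContMDiffAt 𝓘(ℂ, E) 𝓘(ℂ, G) ω f p) (v : TangentSpace 𝓘(ℂ, E) p) :
    dAt E (fun q => c q (f q)) p v = c p (dAt E f p v) + dAt E c p v (f p) := by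
  have hB := isBoundedBilinearMap_apply (𝕜 := ℂ) (E := G) (F := G')
  have h := dAt_comp (F := fun z : (G →L[ℂ] G') × G => z.1 z.2) (f := fun q => (c q, f q))
    (hB.differentiableAt _) (hc.prodMk_space hf) v
  refine h.trans ?_
  rw [hB.fderiv, dAt_prodMk hc hf]
  rfl

theorem dAt_const {E : Type*} [NormedAddCommGroup E] [NormedSpace ℂ E]
    {M : Type*} [TopologicalSpace M] [ChartedSpace E M]
    {G : Type*} [NormedAddCommGroup G] [NormedSpace ℂ G] (c : G) (p : M)
    (v : TangentSpace 𝓘(ℂ, E) p) : dAt E (fun _ : M => c) p v = 0 := by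
  unfold dAt
  rw [mfderiv_const]
  rfl

section Koszul

variable {T : Type*} [AddCommGroup T] [Module ℂ T] [TopologicalSpace T] [IsTopologicalAddGroup T]
  [ContinuousSMul ℂ T] [T2Space T] [FiniteDimensional ℂ T]
  {F : Type*} [NormedAddCommGroup F] [NormedSpace ℂ F]

/-- Koszul's formula for the Christoffel symbols of the first kind, where `D` is the derivative of
the coefficients of the metric in the coordinates `κ`. -/
def koszulCovector (D : T →L[ℂ] F →L[ℂ] F →L[ℂ] ℂ) (κ : T →L[ℂ] F) (u v : T) : T →L[ℂ] ℂ :=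
  LinearMap.toContinuousLinearMap
    { toFun := fun w => (1 / 2 : ℂ) * (D u (κ v) (κ w) + D v (κ u) (κ w) - D w (κ u) (κ v))
      map_add' := fun w w' => by
        simp only [map_add, add_apply]
        ring
      map_smul' := fun c w => by
        simp only [map_smul, smul_apply, smul_eq_mul, RingHom.id_apply]
        ring }

theorem koszulCovector_apply (D : T →L[ℂ] F →L[ℂ] F →L[ℂ] ℂ) (κ : T →L[ℂ] F) (u v w : T) :
    koszulCovector D κ u v w =
      (1 / 2 : ℂ) * (D u (κ v) (κ w) + D v (κ u) (κ w) - D w (κ u) (κ v)) := rfl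

/-- Exchanging `u` and `v` permutes the first two terms, and the third is preserved by the symmetry
of the metric. This is the vanishing of the torsion. -/
theorem koszulCovector_comm {D : T →L[ℂ] F →L[ℂ] F →L[ℂ] ℂ}
    (hD : ∀ w a b, D w a b = D w b a) (κ : T →L[ℂ] F) (u v : T) :
    koszulCovector D κ u v = koszulCovector D κ v u := by
  refine ContinuousLinearMap.ext fun w => ?_
  rw [koszulCovector_apply, koszulCovector_apply, hD w (κ u)]
  ring

theorem koszulCovector_add_left (D : T →L[ℂ] F →L[ℂ] F →L[ℂ] ℂ) (κ : T →L[ℂ] F) (u u' v : T) :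
    koszulCovector D κ (u + u') v = koszulCovector D κ u v + koszulCovector D κ u' v := by
  refine ContinuousLinearMap.ext fun w => ?_
  rw [add_apply, koszulCovector_apply, koszulCovector_apply, koszulCovector_apply]
  simp only [map_add, add_apply]
  ring

theorem koszulCovector_smul_left (D : T →L[ℂ] F →L[ℂ] F →L[ℂ] ℂ) (κ : T →L[ℂ] F) (c : ℂ)
    (u v : T) : koszulCovector D κ (c • u) v = c • koszulCovector D κ u v := by
  refine ContinuousLinearMap.ext fun w => ?_
  rw [smul_apply, koszulCovector_apply, koszulCovector_apply, map_smul, map_smul]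
  simp only [map_smul, smul_apply, smul_eq_mul]
  ring

theorem koszulCovector_add_right (D : T →L[ℂ] F →L[ℂ] F →L[ℂ] ℂ) (κ : T →L[ℂ] F) (u v v' : T) :
    koszulCovector D κ u (v + v') = koszulCovector D κ u v + koszulCovector D κ u v' := by
  refine ContinuousLinearMap.ext fun w => ?_
  rw [add_apply, koszulCovector_apply, koszulCovector_apply, koszulCovector_apply]
  simp only [map_add, add_apply]
  ring

theorem koszulCovector_smul_right (D : T →L[ℂ] F →L[ℂ] F →L[ℂ] ℂ) (κ : T →L[ℂ] F) (c : ℂ)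
    (u v : T) : koszulCovector D κ u (c • v) = c • koszulCovector D κ u v := by
  refine ContinuousLinearMap.ext fun w => ?_
  rw [smul_apply, koszulCovector_apply, koszulCovector_apply, map_smul, map_smul]
  simp only [map_smul, smul_apply, smul_eq_mul]
  ring

/-- The vector-valued form associated with `koszulCovector` by the metric `B`. -/
def koszulTensor {L : Type*} [AddCommGroup L] [Module ℂ L] [TopologicalSpace L]
    [IsTopologicalAddGroup L] [ContinuousSMul ℂ L] (B : T →L[ℂ] T →L[ℂ] L)
    (D : T →L[ℂ] F →L[ℂ] F →L[ℂ] ℂ) (κ : T →L[ℂ] F) (l : L) : T →L[ℂ] T →L[ℂ] T :=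
  clmMk₂ (fun u v => sharpMap B (koszulCovector D κ u v) l)
    (fun u u' v => by rw [koszulCovector_add_left, map_add, add_apply])
    (fun c u v => by rw [koszulCovector_smul_left, map_smul, smul_apply])
    (fun u v v' => by rw [koszulCovector_add_right, map_add, add_apply])
    (fun c u v => by rw [koszulCovector_smul_right, map_smul, smul_apply])

end Koszul

/-! ### Local metrics and their Christoffel tensors -/

section LeviCivita

variable {E : Type*} [NormedAddCommGroup E] [NormedSpace ℂ E]
  {M : Type*} [TopologicalSpace M] [ChartedSpace E M] [IsManifold 𝓘(ℂ, E) ω M]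
  {L : M → Type*}
  [TopologicalSpace (TotalSpace ℂ L)] [∀ x, AddCommGroup (L x)] [∀ x, Module ℂ (L x)]
  [∀ x, TopologicalSpace (L x)] [∀ x, IsTopologicalAddGroup (L x)] [∀ x, ContinuousSMul ℂ (L x)]
  [FiberBundle ℂ L] [VectorBundle ℂ ℂ L]

/-- The frame of the tangent bundle given by the chart at `x`, as a map to the fibre at `p`. -/
abbrev chartFrame (E : Type*) [NormedAddCommGroup E] [NormedSpace ℂ E]
    {M : Type*} [TopologicalSpace M] [ChartedSpace E M] [IsManifold 𝓘(ℂ, E) ω M] (x p : M) :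
    E →L[ℂ] TangentSpace 𝓘(ℂ, E) p :=
  (trivializationAt E (fun p : M => TangentSpace 𝓘(ℂ, E) p) x).symmL ℂ p

/-- The coordinates of a tangent vector at `p` in the chart at `x`. -/
abbrev chartCoord (E : Type*) [NormedAddCommGroup E] [NormedSpace ℂ E]
    {M : Type*} [TopologicalSpace M] [ChartedSpace E M] [IsManifold 𝓘(ℂ, E) ω M] (x p : M) :
    TangentSpace 𝓘(ℂ, E) p →L[ℂ] E :=
  (trivializationAt E (fun p : M => TangentSpace 𝓘(ℂ, E) p) x).continuousLinearMapAt ℂ p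

/-- The coordinate on the fibre `L p` of a line bundle given by the trivialization at `x`. -/
abbrev lineCoord (L : M → Type*)
    [TopologicalSpace (TotalSpace ℂ L)] [∀ x, AddCommGroup (L x)] [∀ x, Module ℂ (L x)]
    [∀ x, TopologicalSpace (L x)] [FiberBundle ℂ L] [VectorBundle ℂ ℂ L] (x p : M) : L p →L[ℂ] ℂ :=
  (trivializationAt ℂ L x).continuousLinearMapAt ℂ p

/-- The transition functions of the tangent bundle. -/
abbrev chartTransition (E : Type*) [NormedAddCommGroup E] [NormedSpace ℂ E]
    {M : Type*} [TopologicalSpace M] [ChartedSpace E M] [IsManifold 𝓘(ℂ, E) ω M] (x y p : M) :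
    E →L[ℂ] E :=
  transition E (fun p : M => TangentSpace 𝓘(ℂ, E) p) x y p

omit [∀ x, IsTopologicalAddGroup (L x)] [∀ x, ContinuousSMul ℂ (L x)] in
theorem lineCoord_eq_mul {x y p : M} (hx : p ∈ (trivializationAt ℂ L x).baseSet)
    (hy : p ∈ (trivializationAt ℂ L y).baseSet) (l : L p) :
    lineCoord L x p l = transition ℂ L x y p 1 * lineCoord L y p l := by
  have h := transition_apply ℂ L hx hy (lineCoord L y p l)
  rw [Trivialization.symmL_continuousLinearMapAt _ hy] at h
  rw [← h]
  conv_lhs => rw [← mul_one (lineCoord L y p l), ← smul_eq_mul, map_smul, smul_eq_mul, mul_comm]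

omit [∀ x, IsTopologicalAddGroup (L x)] [∀ x, ContinuousSMul ℂ (L x)] in
theorem lineCoord_injective {x p : M} (hx : p ∈ (trivializationAt ℂ L x).baseSet) :
    Function.Injective (lineCoord L x p) := fun l l' h => by
  rw [← Trivialization.symmL_continuousLinearMapAt (R := ℂ) _ hx l,
    ← Trivialization.symmL_continuousLinearMapAt (R := ℂ) _ hx l']
  exact congrArg _ h

theorem chartTransition_chartCoord {x y p : M} (hx : p ∈ (chartAt E x).source)
    (hy : p ∈ (chartAt E y).source) (u : TangentSpace 𝓘(ℂ, E) p) :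
    chartTransition E y x p (chartCoord E x p u) = chartCoord E y p u := by
  rw [transition_apply E _ hy hx, Trivialization.symmL_continuousLinearMapAt _ hx]

namespace HolomorphicConformalStructure

variable (g : HolomorphicConformalStructure E L) [FiniteDimensional ℂ E]

/-- The conformal structure in the coordinates given by the chart of `M` and the trivialization
of `L` at `x`. -/
def localForm (x p : M) : E →L[ℂ] E →L[ℂ] ℂ :=
  clmMk₂ (fun a b => lineCoord L x p (g.form p (chartFrame E x p a) (chartFrame E x p b)))
    (fun a a' b => by simp) (fun c a b => by simp) (fun a b b' => by simp) (fun c a b => by simp)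

theorem localForm_apply (x p : M) (a b : E) : g.localForm x p a b =
    lineCoord L x p (g.form p (chartFrame E x p a) (chartFrame E x p b)) := rfl

theorem localForm_comm (x p : M) (a b : E) : g.localForm x p a b = g.localForm x p b a := by
  rw [localForm_apply, localForm_apply, g.symm]

theorem localForm_chartCoord {x p : M} (hx : p ∈ (chartAt E x).source)
    (u v : TangentSpace 𝓘(ℂ, E) p) :
    g.localForm x p (chartCoord E x p u) (chartCoord E x p v) = lineCoord L x p (g.form p u v) := by
  rw [localForm_apply, Trivialization.symmL_continuousLinearMapAt _ hx,
    Trivialization.symmL_continuousLinearMapAt _ hx]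

/-- The open set on which both the chart of `M` and the trivialization of `L` at `x` are defined. -/
def frameDomain (L : M → Type*) [TopologicalSpace (TotalSpace ℂ L)] [∀ x, AddCommGroup (L x)]
    [∀ x, Module ℂ (L x)] [∀ x, TopologicalSpace (L x)] [FiberBundle ℂ L] (E : Type*)
    [NormedAddCommGroup E] [ChartedSpace E M] (x : M) : Opens M :=
  ⟨(chartAt E x).source ∩ (trivializationAt ℂ L x).baseSet,
    (chartAt E x).open_source.inter (trivializationAt ℂ L x).open_baseSet⟩

theorem contMDiffOn_localForm [ContMDiffVectorBundle ω ℂ L 𝓘(ℂ, E)] (x : M) :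
    ContMDiffOn 𝓘(ℂ, E) 𝓘(ℂ, E →L[ℂ] E →L[ℂ] ℂ) ω (g.localForm x) (frameDomain L E x) := by
  intro p hp
  apply ContMDiffAt.contMDiffWithinAt
  refine contMDiffAt_clm_of_apply fun a => contMDiffAt_clm_of_apply fun b => ?_
  have hc : ∀ a : E, HolOn E E (frameDomain L E x : Set M) (fun q => chartFrame E x q a) := fun a =>
    HolOn.symmL E E (fun p : M => TangentSpace 𝓘(ℂ, E) p) x
      (U := (frameDomain L E x : Set M)) (by exact fun q hq => hq.1) (f := fun _ => a)
      contMDiffOn_const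
  have h1 := HolOn.apply (HolOn.apply (HolOn.mono g.holomorphic (subset_univ _)) (hc a)) (hc b)
  have h2 := HolOn.continuousLinearMapAt E ℂ L x (U := (frameDomain L E x : Set M))
    (fun q hq => hq.2) h1
  exact h2.contMDiffAt ((frameDomain L E x).2.mem_nhds hp)

/-- The trivializations of `L` contribute the conformal factor, the charts the tangent transition
functions. Differentiating this relation produces the `dlog` terms and the Hessian terms of the
comparison of connections. -/
theorem localForm_eq_mul {x y p : M} (hx : p ∈ frameDomain L E x) (hy : p ∈ frameDomain L E y)
    (a b : E) : g.localForm x p a b = transition ℂ L x y p 1 *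
      g.localForm y p (chartTransition E y x p a) (chartTransition E y x p b) := by
  rw [localForm_apply, lineCoord_eq_mul hx.2 hy.2, ← g.localForm_chartCoord hy.1,
    transition_apply E _ hy.1 hx.1, transition_apply E _ hy.1 hx.1]

/-- The arguments `a` and `b` are constant, so the product rule leaves one term. In this form
pointwise identities for the metric coefficients pass to their derivatives. -/
theorem dAt_localForm_apply [ContMDiffVectorBundle ω ℂ L 𝓘(ℂ, E)] {x p : M}
    (hx : p ∈ frameDomain L E x) (a b : E) (w : TangentSpace 𝓘(ℂ, E) p) :
    dAt E (fun q => g.localForm x q a b) p w = dAt E (g.localForm x) p w a b := by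
  have hG := (g.contMDiffOn_localForm x).contMDiffAt ((frameDomain L E x).2.mem_nhds hx)
  rw [dAt_clm_apply (hG.clm_apply contMDiffAt_const) contMDiffAt_const, dAt_const,
    dAt_clm_apply hG contMDiffAt_const, dAt_const, map_zero, map_zero, zero_add, zero_add]

/-- The transformation law of the first derivatives of the metric coefficients. -/
theorem dAt_localForm [ContMDiffVectorBundle ω ℂ L 𝓘(ℂ, E)] {x y p : M}
    (hx : p ∈ frameDomain L E x) (hy : p ∈ frameDomain L E y) (u v w : TangentSpace 𝓘(ℂ, E) p) :
    dAt E (g.localForm x) p w (chartCoord E x p u) (chartCoord E x p v) =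
      dAt E (fun q => transition ℂ L x y q 1) p w *
        g.localForm y p (chartCoord E y p u) (chartCoord E y p v) +
      transition ℂ L x y p 1 *
        (dAt E (g.localForm y) p w (chartCoord E y p u) (chartCoord E y p v) +
          g.localForm y p (dAt E (chartTransition E y x) p w (chartCoord E x p u))
            (chartCoord E y p v) +
          g.localForm y p (chartCoord E y p u)
            (dAt E (chartTransition E y x) p w (chartCoord E x p v))) := by
  set a := chartCoord E x p u
  set b := chartCoord E x p v
  have hGy := (g.contMDiffOn_localForm y).contMDiffAt ((frameDomain L E y).2.mem_nhds hy)
  have hm := (contMDiffOn_transition_one E L x y).contMDiffAt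
      (((trivializationAt ℂ L x).open_baseSet.inter
        (trivializationAt ℂ L y).open_baseSet).mem_nhds ⟨hx.2, hy.2⟩)
  have hh := (contMDiffOn_transition E E (fun p : M => TangentSpace 𝓘(ℂ, E) p) y x).contMDiffAt
    (((chartAt E y).open_source.inter (chartAt E x).open_source).mem_nhds ⟨hy.1, hx.1⟩)
  have e2 : dAt E (fun q => g.localForm x q a b) p = dAt E (fun q => transition ℂ L x y q 1 *
      g.localForm y q (chartTransition E y x q a) (chartTransition E y x q b)) p := by
    apply dAt_congr
    filter_upwards [(frameDomain L E x).2.mem_nhds hx, (frameDomain L E y).2.mem_nhds hy]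
      with q hq hq'
    exact g.localForm_eq_mul hq hq' a b
  have e3 : ∀ c : E, dAt E (fun q => chartTransition E y x q c) p w =
      dAt E (chartTransition E y x) p w c := fun c => by
    rw [dAt_clm_apply hh contMDiffAt_const, dAt_const, map_zero, zero_add]
  have ha : ∀ c : E, ContMDiffAt 𝓘(ℂ, E) 𝓘(ℂ, E) ω (fun q => chartTransition E y x q c) p :=
    fun c => hh.clm_apply contMDiffAt_const
  rw [← g.dAt_localForm_apply hx, e2, dAt_mul hm ((hGy.clm_apply (ha a)).clm_apply (ha b)),
    dAt_clm_apply (hGy.clm_apply (ha a)) (ha b), dAt_clm_apply hGy (ha a), e3, e3,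
    chartTransition_chartCoord hx.1 hy.1, chartTransition_chartCoord hx.1 hy.1,
    _root_.add_apply]
  ring

/-- The tensor which sends the vectors `u` and `v` to `∇_u V`, where `∇` is the Levi-Civita
connection of the local metric `g.localForm x` and `V` extends `v` with constant coefficients in
the chart at `x`. -/
def christoffel (x p : M) :
    TangentSpace 𝓘(ℂ, E) p →L[ℂ] TangentSpace 𝓘(ℂ, E) p →L[ℂ] TangentSpace 𝓘(ℂ, E) p :=
  koszulTensor (g.form p) (dAt E (g.localForm x) p) (chartCoord E x p)
    ((trivializationAt ℂ L x).symmL ℂ p 1)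

theorem christoffel_apply (x p : M) (u v : TangentSpace 𝓘(ℂ, E) p) : g.christoffel x p u v =
    sharpMap (g.form p) (koszulCovector (dAt E (g.localForm x) p) (chartCoord E x p) u v)
      ((trivializationAt ℂ L x).symmL ℂ p 1) := rfl

theorem christoffel_comm [ContMDiffVectorBundle ω ℂ L 𝓘(ℂ, E)] {x p : M}
    (hx : p ∈ frameDomain L E x) (u v : TangentSpace 𝓘(ℂ, E) p) :
    g.christoffel x p u v = g.christoffel x p v u := by
  rw [christoffel_apply, christoffel_apply]
  congr 2
  refine koszulCovector_comm (fun w a b => ?_) _ _ _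
  rw [← g.dAt_localForm_apply hx, ← g.dAt_localForm_apply hx]
  simp only [g.localForm_comm x _ a b]

/-- The chosen frame vector of `L` has coordinate `1`, so pairing with the metric undoes the raising
of the index. The comparison of connections can thus be carried out on covectors, without inverting
the metric. -/
theorem lineCoord_christoffel {x p : M} (hx : p ∈ frameDomain L E x)
    (u v w : TangentSpace 𝓘(ℂ, E) p) :
    lineCoord L x p (g.form p (g.christoffel x p u v) w) = 
      koszulCovector (dAt E (g.localForm x) p) (chartCoord E x p) u v w := by
  rw [christoffel_apply, g.form_sharpMap, map_smul,
    Trivialization.continuousLinearMapAt_symmL _ hx.2, smul_eq_mul, mul_one]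

end HolomorphicConformalStructure
end LeviCivita

/-! ### Holomorphy of the Christoffel tensors and their conformal change -/

section LeviCivita

variable {E : Type*} [NormedAddCommGroup E] [NormedSpace ℂ E]
  {M : Type*} [TopologicalSpace M] [ChartedSpace E M] [IsManifold 𝓘(ℂ, E) ω M]
  {L : M → Type*}
  [TopologicalSpace (TotalSpace ℂ L)] [∀ x, AddCommGroup (L x)] [∀ x, Module ℂ (L x)]
  [∀ x, TopologicalSpace (L x)] [∀ x, IsTopologicalAddGroup (L x)] [∀ x, ContinuousSMul ℂ (L x)]
  [FiberBundle ℂ L] [VectorBundle ℂ ℂ L]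

namespace HolomorphicConformalStructure

variable (g : HolomorphicConformalStructure E L) [FiniteDimensional ℂ E]
  [ContMDiffVectorBundle ω ℂ L 𝓘(ℂ, E)]

theorem holOn_sharpMap {U : Set M} (hU : IsOpen U) {ξ : Π p : M, TangentSpace 𝓘(ℂ, E) p →L[ℂ] ℂ}
    (hξ : HolOn E (E →L[ℂ] ℂ) U ξ) :
    HolOn E (ℂ →L[ℂ] E) U (fun p => sharpMap (g.form p) (ξ p)) := by
  obtain ⟨t, ht, hts⟩ := g.sharp.map_mem ⟨U, hU⟩ (fun p => ξ p) ⟨ξ, hξ, fun _ => rfl⟩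
  exact HolOn.congr ht fun p hp => (hts ⟨p, hp⟩).symm

theorem contMDiffOn_dAt_localForm {x : M} {W : Set M} (hWo : IsOpen W)
    (hW : W ⊆ frameDomain L E x) {u v w : Π p : M, TangentSpace 𝓘(ℂ, E) p}
    (hu : HolOn E E W u) (hv : HolOn E E W v) (hw : HolOn E E W w) :
    ContMDiffOn 𝓘(ℂ, E) 𝓘(ℂ, ℂ) ω (fun p => dAt E (g.localForm x) p (w p)
      (chartCoord E x p (u p)) (chartCoord E x p (v p))) W := by
  have hWx : W ⊆ (trivializationAt E (fun p : M => TangentSpace 𝓘(ℂ, E) p) x).baseSet :=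
    fun p hp => (hW hp).1
  have h1 := contMDiffOn_dAt_apply hWo ((g.contMDiffOn_localForm x).mono hW) hw
  exact (h1.clm_apply (hu.continuousLinearMapAt E E _ x hWx)).clm_apply
    (hv.continuousLinearMapAt E E _ x hWx)

theorem holOn_christoffel (x : M) :
    HolOn E (E →L[ℂ] E →L[ℂ] E) (frameDomain L E x : Set M) (g.christoffel x) := by
  refine holOn_hom (frameDomain L E x).2 fun W hW hWo u hu => holOn_hom hWo fun W' hW' hWo' v hv => ?_
  have hu' := HolOn.mono hu hW'
  have hξ : HolOn E (E →L[ℂ] ℂ) W' (fun p =>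
      koszulCovector (dAt E (g.localForm x) p) (chartCoord E x p) (u p) (v p)) := by
    refine holOn_hom hWo' fun O hO hOo w hw => holOn_const_iff.2 ?_
    have hO' : O ⊆ frameDomain L E x := (hO.trans hW').trans hW
    have hu'' := HolOn.mono hu' hO
    have hv'' := HolOn.mono hv hO
    have h0 : ContMDiffOn 𝓘(ℂ, E) 𝓘(ℂ, ℂ) ω (fun _ : M => (1 / 2 : ℂ)) O := contMDiffOn_const
    exact h0.smul (((g.contMDiffOn_dAt_localForm hOo hO' hv'' hw hu'').add
      (g.contMDiffOn_dAt_localForm hOo hO' hu'' hw hv'')).sub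
      (g.contMDiffOn_dAt_localForm hOo hO' hu'' hv'' hw))
  have hσ : HolOn E ℂ W' (fun p => (trivializationAt ℂ L x).symmL ℂ p 1) :=
    HolOn.symmL E ℂ L x (fun p hp => (hW (hW' hp)).2) (f := fun _ => 1) contMDiffOn_const
  have h1 := HolOn.apply (g.holOn_sharpMap hWo' hξ) hσ
  exact h1

/-- The difference of the Levi-Civita connections of two conformal local metrics. -/
theorem atiyahForm_eq_christoffel_sub {x y p : M}
    (hx : p ∈ frameDomain L E x) (hy : p ∈ frameDomain L E y) :
    atiyahForm E E (fun p : M => TangentSpace 𝓘(ℂ, E) p) y x p =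
      (2 * Real.pi * Complex.I : ℂ)⁻¹ • (g.christoffel x p - g.christoffel y p) -
      (1 / 2 : ℂ) • (symProdMap _ (dlogForm E L x y p) -
        tensorMap (g.form p) (sharpMap (g.form p) (dlogForm E L x y p))) := by
  refine ContinuousLinearMap.ext fun u => ContinuousLinearMap.ext fun v => ?_
  -- By nondegeneracy it is enough to compare pairings with every `w`, in the coordinate of `L` at
  -- `x`.
  refine (g.isInvertible p).injective (ContinuousLinearMap.ext fun w =>
    lineCoord_injective hx.2 ?_)
  let m := transition ℂ L x y p 1
  have hm : m ≠ 0 := transition_one_ne_zero L x y p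
  let β := fun a b : TangentSpace 𝓘(ℂ, E) p => lineCoord L x p (g.form p a b)
  have hβ : ∀ a b, β a b = m * g.localForm y p (chartCoord E y p a) (chartCoord E y p b) :=
    fun a b => by rw [g.localForm_chartCoord hy.1, ← lineCoord_eq_mul hx.2 hy.2]
  let dm := fun w => dAt E (fun q => transition ℂ L x y q 1) p w
  have hξ : ∀ w, dlogForm E L x y p w = (2 * Real.pi * Complex.I : ℂ)⁻¹ * (m⁻¹ * dm w) :=
    fun w => rfl
  let H := dAt E (chartTransition E y x) p u (chartCoord E x p v)
  have e1 : β (atiyahForm E E (fun p : M => TangentSpace 𝓘(ℂ, E) p) y x p u v) w =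
      (2 * Real.pi * Complex.I : ℂ)⁻¹ * (m * g.localForm y p H (chartCoord E y p w)) := by
    rw [hβ, atiyahForm_apply, map_smul, Trivialization.continuousLinearMapAt_symmL _ hy.1, map_smul,
      smul_apply, smul_eq_mul]
    ring
  have e2 : β (g.christoffel x p u v) w =
      koszulCovector (dAt E (g.localForm x) p) (chartCoord E x p) u v w :=
    g.lineCoord_christoffel hx u v w
  have e3 : β (g.christoffel y p u v) w =
      m * koszulCovector (dAt E (g.localForm y) p) (chartCoord E y p) u v w := by
    rw [← g.lineCoord_christoffel hy, ← lineCoord_eq_mul hx.2 hy.2]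
  have e4 : β (tensorMap (g.form p) (sharpMap (g.form p) (dlogForm E L x y p)) u v) w =
      dlogForm E L x y p w * β u v :=
    (congrArg (lineCoord L x p) (g.form_sharpMap p (dlogForm E L x y p) (g.form p u v) w)).trans
      (map_smul (lineCoord L x p) _ _)
  have e5 : β (symProdMap _ (dlogForm E L x y p) u v) w =
      dlogForm E L x y p u * β v w + dlogForm E L x y p v * β u w := by
    simp only [β, symProdMap_apply, map_add, map_smul, add_apply, smul_apply, smul_eq_mul]
  have hl : ∀ (c d : ℂ) (a a' b b' : TangentSpace 𝓘(ℂ, E) p),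
      β (c • (a - a') - d • (b - b')) w = c * (β a w - β a' w) - d * (β b w - β b' w) := by
    intro c d a a' b b'
    simp only [β, map_sub, map_smul, sub_apply, smul_apply, smul_eq_mul]
  refine Eq.trans ?_ (hl (2 * Real.pi * Complex.I : ℂ)⁻¹ (1 / 2) (g.christoffel x p u v)
    (g.christoffel y p u v) (symProdMap _ (dlogForm E L x y p) u v)
    (tensorMap (g.form p) (sharpMap (g.form p) (dlogForm E L x y p)) u v)).symm
  refine e1.trans ?_
  -- Koszul's formula at `x` is rewritten in the data at `y`. It contains six Hessian terms; by the
  -- symmetry of the Hessian and of the metric four of them cancel, and the other two both equal the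
  -- pairing of `H` with `w`.
  rw [e2, e3, e4, e5, koszulCovector_apply, koszulCovector_apply, g.dAt_localForm hx hy,
    g.dAt_localForm hx hy, g.dAt_localForm hx hy, hβ, hβ, hβ, hξ, hξ, hξ,
    dAt_transition_tangent_symm (E := E) hx.1 hy.1 w u,
    dAt_transition_tangent_symm (E := E) hx.1 hy.1 w v,
    dAt_transition_tangent_symm (E := E) hx.1 hy.1 v u,
    g.localForm_comm y p (dAt E (chartTransition E y x) p u (chartCoord E x p w))]
  have hmm : m⁻¹ * m = 1 := inv_mul_cancel₀ hm
  generalize (2 * Real.pi * Complex.I : ℂ)⁻¹ = c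
  change c * (m * g.localForm y p H _) = c * ((1 / 2) * (dm u * _ + m * (_ + g.localForm y p H _ + _) +
    (dm v * _ + m * (_ + g.localForm y p H _ + _)) - (dm w * _ + m * (_ + _ + _))) - m * _) - _
  -- Only the `dm` terms remain: each `dlog` term carries `m⁻¹` and each pairing `m`, so the
  -- cancellation `m⁻¹ * m = 1` settles them.
  linear_combination (1 / 2 : ℂ) * c *
    (dm u * g.localForm y p (chartCoord E y p v) (chartCoord E y p w) +
      dm v * g.localForm y p (chartCoord E y p u) (chartCoord E y p w) -
      dm w * g.localForm y p (chartCoord E y p u) (chartCoord E y p v)) * hmm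

end HolomorphicConformalStructure
end LeviCivita

/-! ### The formula in terms of `c₁(L)`, and the relation between `c₁(L)` and `c₁(K_M)` -/

section ConformalClass

variable {E : Type*} [NormedAddCommGroup E] [NormedSpace ℂ E] [FiniteDimensional ℂ E]
  {M : Type*} [TopologicalSpace M] [ChartedSpace E M] [IsManifold 𝓘(ℂ, E) ω M]
  {L : M → Type*}
  [TopologicalSpace (TotalSpace ℂ L)] [∀ x, AddCommGroup (L x)] [∀ x, Module ℂ (L x)]
  [∀ x, TopologicalSpace (L x)] [∀ x, IsTopologicalAddGroup (L x)] [∀ x, ContinuousSMul ℂ (L x)]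
  [FiberBundle ℂ L] [VectorBundle ℂ ℂ L] [ContMDiffVectorBundle ω ℂ L 𝓘(ℂ, E)]

namespace HolomorphicConformalStructure

variable (g : HolomorphicConformalStructure E L)

variable (E L) in
/-- The cover of `M` by the open sets `frameDomain`. -/
def frameCover : PointCover M where
  nhd x := frameDomain L E x
  mem_nhd x := ⟨mem_chart_source E x, mem_baseSet_trivializationAt ℂ L x⟩

/-- The 0-cochain of the Christoffel tensors of the local metrics. -/
def christoffelCochain : (symSheaf E M).C0 (frameCover E L) := fun x =>
  ⟨fun p => g.christoffel x p, ⟨g.christoffel x, g.holOn_christoffel x, fun _ => rfl⟩,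
    fun p _ u v => g.christoffel_comm p.2 u v⟩

/-- The class `a(Ω¹)` in terms of the first Chern class of `L`. -/
theorem cls_hessianCocycle : (symSheaf E M).cls (hessianCocycle E M) =
    (-1 / 2 : ℂ) • (symProd E M).mapH1 (firstChern E L) +
      (1 / 2 : ℂ) • g.tensor.mapH1 (g.sharp.mapH1 (firstChern E L)) := by
  -- The three classes are given on different covers; the frame domains refine both, which allows a
  -- comparison of cocycles.
  have hU : trivCover (CovectorModel E) (fun p : M => Cotangent E p) ≤ frameCover E L :=
    fun x p hp => ⟨hp.1, trivial⟩
  have hV : trivCover ℂ L ≤ frameCover E L := fun x p hp => hp.2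
  let f₁ := (symSheaf E M).refineZ1 hU (hessianCocycle E M)
  let f₂ := (symSheaf E M).refineZ1 hV ((symProd E M).mapZ1 _ (chernCocycle E L))
  let f₃ := (symSheaf E M).refineZ1 hV (g.tensor.mapZ1 _ (g.sharp.mapZ1 _ (chernCocycle E L)))
  have e₁ : (symSheaf E M).cls f₁ = (symSheaf E M).cls (hessianCocycle E M) :=
    SectionPresheaf.cls_refineZ1 hU _
  have e₂ : (symSheaf E M).cls f₂ = (symProd E M).mapH1 (firstChern E L) :=
    (SectionPresheaf.cls_refineZ1 hV _).trans (SectionPresheaf.mapH1_cls _ _).symm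
  have e₃ : (symSheaf E M).cls f₃ = g.tensor.mapH1 (g.sharp.mapH1 (firstChern E L)) :=
    (SectionPresheaf.cls_refineZ1 hV _).trans ((SectionPresheaf.mapH1_cls _ _).symm.trans
      (congrArg _ (SectionPresheaf.mapH1_cls _ _).symm))
  rw [← e₁, ← e₂, ← e₃, ← SectionPresheaf.cls_smul, ← SectionPresheaf.cls_smul,
    ← SectionPresheaf.cls_add]
  refine SectionPresheaf.cls_eq_of_sub_eq_d0
    -- Since `(δf)_{xy} = f_y - f_x`, the minus sign produces `Γ_x - Γ_y`, the order in
    -- `atiyahForm_eq_christoffel_sub`.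
    (-(2 * Real.pi * Complex.I : ℂ)⁻¹ • g.christoffelCochain) ?_
  refine funext fun x => funext fun y => Subtype.ext (funext fun p => ?_)
  change -(2 * Real.pi * Complex.I : ℂ)⁻¹ • g.christoffel y p -
      -(2 * Real.pi * Complex.I : ℂ)⁻¹ • g.christoffel x p =
    atiyahForm E E (fun p : M => TangentSpace 𝓘(ℂ, E) p) y x p -
      ((-1 / 2 : ℂ) • symProdMap _ (dlogForm E L x y p) +
        (1 / 2 : ℂ) • tensorMap (g.form p) (sharpMap (g.form p) (dlogForm E L x y p)))
  rw [g.atiyahForm_eq_christoffel_sub p.2.1 p.2.2]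
  module

theorem symTrace_tensor_sharp (c : H1Form E M) :
    (symTrace E M).mapH1 (g.tensor.mapH1 (g.sharp.mapH1 c)) = c := by
  obtain ⟨𝒰, f, rfl⟩ := SectionPresheaf.exists_cls_eq c
  have h1 := SectionPresheaf.mapH1_cls g.sharp f
  have h2 := SectionPresheaf.mapH1_cls g.tensor (g.sharp.mapZ1 𝒰 f)
  have h3 := SectionPresheaf.mapH1_cls (symTrace E M) (g.tensor.mapZ1 𝒰 (g.sharp.mapZ1 𝒰 f))
  refine (congrArg _ ((congrArg _ h1).trans h2)).trans (h3.trans (congrArg (formSheaf E M).cls ?_))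
  refine Subtype.ext (funext fun x => funext fun y => Subtype.ext (funext fun p => ?_))
  have hL : Module.finrank ℂ (L p) = 1 := by
    rw [((trivializationAt ℂ L p).continuousLinearEquivAt ℂ p
      (mem_baseSet_trivializationAt ℂ L p)).toLinearEquiv.finrank_eq, Module.finrank_self]
  exact traceMap_tensorMap_sharpMap hL (g.symm p) _ (g.form_sharpMap p _)

end HolomorphicConformalStructure

theorem symTrace_symProd (c : H1Form E M) :
    (symTrace E M).mapH1 ((symProd E M).mapH1 c) = ((Module.finrank ℂ E : ℂ) + 1) • c := by
  refine (SectionPresheaf.mapH1_eq_comp (χ := SectionPresheaf.Hom.scalar (formSheaf E M)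
    ((Module.finrank ℂ E : ℂ) + 1)) (fun U s hs p => ?_) c).trans
    (SectionPresheaf.Hom.scalar_mapH1 _ c)
  exact traceMap_symProdMap (s p)

/-- The relation `c₁(L) = -(2 / n) c₁(K_M)`. -/
theorem HolomorphicConformalStructure.canonicalClass_eq (g : HolomorphicConformalStructure E L) :
    canonicalClass E M = (-(Module.finrank ℂ E : ℂ) / 2) • (firstChern E L : H1Form E M) := by
  -- The trace of the formula gives the coefficient `-½ (n + 1) + ½ = -n/2`; the determinant of `ω`
  -- is not needed.
  have h := congrArg (symTrace E M).mapH1 g.cls_hessianCocycle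
  rw [map_add, map_smul, map_smul] at h
  refine symTrace_hessianCocycle.symm.trans (h.trans ?_)
  refine (congrArg₂ (fun a b : H1Form E M => (-1 / 2 : ℂ) • a + (1 / 2 : ℂ) • b)
    (symTrace_symProd (firstChern E L)) (g.symTrace_tensor_sharp (firstChern E L))).trans ?_
  have e : ∀ c : H1Form E M, (-1 / 2 : ℂ) • ((Module.finrank ℂ E : ℂ) + 1) • c + (1 / 2 : ℂ) • c =
      (-(Module.finrank ℂ E : ℂ) / 2) • c := fun c => by module
  exact e _

end ConformalClass
end

theorem proposition2p1
    {E : Type*} [NormedAddCommGroup E] [NormedSpace ℂ E] [FiniteDimensional ℂ E]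
    {M : Type*} [TopologicalSpace M] [ChartedSpace E M] [IsManifold 𝓘(ℂ, E) ω M]
    (L : M → Type*) [TopologicalSpace (TotalSpace ℂ L)]
    [∀ p, AddCommGroup (L p)] [∀ p, Module ℂ (L p)] [∀ p, TopologicalSpace (L p)]
    [∀ p, IsTopologicalAddGroup (L p)] [∀ p, ContinuousSMul ℂ (L p)]
    [FiberBundle ℂ L] [VectorBundle ℂ ℂ L] [ContMDiffVectorBundle ω ℂ L 𝓘(ℂ, E)]
    (n : ℕ) (hn : 0 < n) (hdim : Module.finrank ℂ E = n)
    (g : HolomorphicConformalStructure E L) :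
    -- `H¹(M, S²Ω¹ ⊗ T_M)` is a subspace of `H¹(M, Ω¹ ⊗ End Ω¹)`,
    Function.Injective (symInclusionH1 E M) ∧
    -- which contains `A = a(Ω¹)` and `S = id ⊗ c₁(K_M)/n + c₁(K_M)/n ⊗ id`,
    ∃ A S : H1Sym E M,
      symInclusionH1 E M A = atiyahClassCotangent E M ∧
      symInclusionH1 E M S = idTensorH1 E M ((1 / n : ℂ) • canonicalClass E M) +
        tensorIdH1 E M ((1 / n : ℂ) • canonicalClass E M) ∧
      -- and the formula holds in it.
      A = S - (1 / n : ℂ) • g.tensorSharpH1 (canonicalClass E M) := by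
  have hn' : (n : ℂ) ≠ 0 := Nat.cast_ne_zero.2 hn.ne'
  let s : H1Form E M →ₗ[ℂ] H1Sym E M := (symProd E M).mapH1
  let c : H1Form E M := firstChern E L
  refine ⟨symInclusionH1_injective E M, (symSheaf E M).cls (hessianCocycle E M),
    s ((1 / n : ℂ) • canonicalClass E M), symInclusionH1_hessianCocycle,
    symInclusionH1_symProd E M _, ?_⟩
  have h : canonicalClass E M = (-(n : ℂ) / 2) • c := hdim ▸ g.canonicalClass_eq
  have h' : ((symSheaf E M).cls (hessianCocycle E M) : H1Sym E M) =
    (-1 / 2 : ℂ) • s c + (1 / 2 : ℂ) • g.tensorSharpH1 c := g.cls_hessianCocycle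
  rw [h', h, map_smul, map_smul, map_smul, smul_smul, smul_smul]
  -- Hence `c₁(K_M)/n = -½ c₁(L)`, which matches the coefficients of `h'`: `-½` on the symmetric
  -- product, and `½` on the last term because it is subtracted.
  have e : (1 / n : ℂ) * (-(n : ℂ) / 2) = -1 / 2 := by field_simp
  rw [e]
  module
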